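/- Let $\mathfrak A=\left(\frac{-1,-1}{\mathbb Q}\right)=\mathbb Q[u,v\mid u^2=v^2=-1,\ uv+vu=0]$ be the rational Hamilton quaternion algebra, let $w=\tfrac12(-1+u+v+uv)$, and let $G_H=\langle w,u,v\rangle\subseteq\mathfrak A^{*}$ be the Hurwitz unit group. For an algebraic extension $E$ of $\mathbb Q_p$, let $\mathcal O_E$ be the integral closure of $\mathbb Z_p$ in $E$ and let $e(E/\mathbb Q_p)\in\{1,2,\dots\}\cup\{\infty\}$ be the ramification index, i.e. the index of the value group of $\mathbb Q_p$ in that of $E$. If $E$ splits $\mathfrak A$, let $\rho:G_H\to\mathrm{GL}_2(E)$ be the representation obtained by restricting to $G_H$ an isomorphism of $E$-algebras $E\otimes_{\mathbb Q}\mathfrak A\cong\mathbb M_2(E)$, and let $\mathrm{IF}_\rho^{G_H}(E)$ be the set of $\mathrm{GL}_2(\mathcal O_E)$-conjugacy classes of representations $\rho':G_H\to\mathrm{GL}_2(\mathcal O_E)$ that are $\mathrm{GL}_2(E)$-conjugate to $\rho$. (1) Let $E$ be a Galois extension of $\mathbb Q_2$ containing a quadratic extension of $\mathbb Q_2$. Then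 $E$ splits $\mathfrak A$, and for every such $\rho$ the set $\mathrm{IF}_\rho^{G_H}(E)$ has exactly $e(E/\mathbb Q_2)+1$ elements if $\sqrt{-3}\in E$, while it is a singleton if $\sqrt{-3}\notin E$. (2) Let $p\neq 2$ be a prime and let $E$ be any algebraic extension of $\mathbb Q_p$. Then $E$ splits $\mathfrak A$, and for every such $\rho$ the set $\mathrm{IF}_\rho^{G_H}(E)$ is a singleton. -/

import Mathlib

open scoped TensorProduct Quaternion

noncomputable section

/-- The representations `ρ' : G → GL_n(R)` which become `GL_n(K)`-conjugate to `ρ : G → GL_n(K)`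
after extension of scalars from `R` to `K`. -/
def IntegralRep (R : Type*) [CommRing R] {K : Type*} [Field K] [Algebra R K]
    {G : Type*} [Group G] {n : ℕ} (ρ : G →* GL (Fin n) K) : Type _ :=
  {ρ' : G →* GL (Fin n) R //
    ∃ g : GL (Fin n) K, ∀ x : G,
      Matrix.GeneralLinearGroup.map (algebraMap R K) (ρ' x) = g * ρ x * g⁻¹}

/-- `GL_n(R)`-conjugacy of integral representations. -/
def integralRepSetoid (R : Type*) [CommRing R] {K : Type*} [Field K] [Algebra R K]
    {G : Type*} [Group G] {n : ℕ} (ρ : G →* GL (Fin n) K) : Setoid (IntegralRep R ρ) where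
  r ρ₁ ρ₂ := ∃ h : GL (Fin n) R, ∀ x : G, ρ₂.1 x = h * ρ₁.1 x * h⁻¹
  iseqv :=
    { refl := fun _ => ⟨1, fun x => by simp⟩
      symm := by
        rintro _ _ ⟨h, hh⟩
        exact ⟨h⁻¹, fun x => by rw [hh x]; group⟩
      trans := by
        rintro _ _ _ ⟨h, hh⟩ ⟨k, hk⟩
        exact ⟨k * h, fun x => by rw [hk x, hh x]; group⟩ }

/-- The set `IF_ρ^G` of integral forms of `ρ`: the `GL_n(R)`-conjugacy classes of representations
`G → GL_n(R)` that are `GL_n(K)`-conjugate to `ρ`. -/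
def IntegralForms (R : Type*) [CommRing R] {K : Type*} [Field K] [Algebra R K]
    {G : Type*} [Group G] {n : ℕ} (ρ : G →* GL (Fin n) K) : Type _ :=
  Quotient (integralRepSetoid R ρ)

/-- The ring of integers `𝒪_E` of an algebraic extension `E` of `ℚ_p`: the integral closure of
`ℤ_p` in `E`. -/
abbrev padicIntegers (p : ℕ) [Fact p.Prime] (E : Type*) [Field E] [Algebra ℚ_[p] E] :
    Subalgebra (PadicInt.subring p) E :=
  integralClosure (PadicInt.subring p) E

/-- The ramification index `e(E/ℚ_p)` of an algebraic extension `E` of `ℚ_p`, that is, the index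
`(v(Eˣ) : v(ℚ_pˣ))` of value groups. The valuation `v` is the projection onto its value group
`v(Eˣ) = Eˣ/𝒪_Eˣ`, so this is the index of `ℚ_pˣ 𝒪_Eˣ` in `Eˣ`. It is `⊤` when the index is
infinite, which can only happen for infinite extensions. -/
def ramificationIndex (p : ℕ) [Fact p.Prime] (E : Type*) [Field E] [Algebra ℚ_[p] E] : ℕ∞ :=
  ENat.card (Eˣ ⧸
    ((Units.map (algebraMap ℚ_[p] E : ℚ_[p] →* E)).range ⊔
      (Units.map (algebraMap (padicIntegers p E) E : padicIntegers p E →* E)).range))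

/-- The quaternion `𝐮` of `𝔄 = (-1,-1 / ℚ)`, as a unit. -/
def hurwitzU : ℍ[ℚ]ˣ :=
  Units.mk0 ⟨0, 1, 0, 0⟩ fun h => by simpa using congrArg QuaternionAlgebra.imI h

/-- The quaternion `𝐯` of `𝔄 = (-1,-1 / ℚ)`, as a unit. -/
def hurwitzV : ℍ[ℚ]ˣ :=
  Units.mk0 ⟨0, 0, 1, 0⟩ fun h => by simpa using congrArg QuaternionAlgebra.imJ h

/-- The quaternion `𝐰 = (-1 + 𝐮 + 𝐯 + 𝐮𝐯)/2` of `𝔄 = (-1,-1 / ℚ)`, as a unit. -/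
def hurwitzW : ℍ[ℚ]ˣ :=
  Units.mk0 ⟨-1 / 2, 1 / 2, 1 / 2, 1 / 2⟩ fun h => by
    simpa using congrArg QuaternionAlgebra.imI h

/-- The Hurwitz unit group `G_H = ⟨𝐰, 𝐮, 𝐯⟩`. -/
def hurwitzGroup : Subgroup ℍ[ℚ]ˣ :=
  Subgroup.closure {hurwitzW, hurwitzU, hurwitzV}

/-- The splittings over `E` of the rational Hamilton quaternion algebra `𝔄 = (-1,-1 / ℚ)`: the
isomorphisms of `E`-algebras `𝔄_E = E ⊗ 𝔄 ≅ M₂(E)`. -/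
abbrev HamiltonSplitting (E : Type*) [Field E] [CharZero E] : Type _ :=
  E ⊗[ℚ] ℍ[ℚ] ≃ₐ[E] Matrix (Fin 2) (Fin 2) E

/-- The representation `ρ : G_H → GL₂(E)` obtained by extending scalars to `E`, through a splitting
`𝔄_E ≅ M₂(E)`. -/
def hurwitzRep {E : Type*} [Field E] [CharZero E] (f : HamiltonSplitting E) :
    hurwitzGroup →* GL (Fin 2) E :=
  (Units.map
    ((f.toAlgHom.toRingHom.comp
      (Algebra.TensorProduct.includeRight : ℍ[ℚ] →ₐ[ℚ] E ⊗[ℚ] ℍ[ℚ]).toRingHom) :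
        ℍ[ℚ] →* Matrix (Fin 2) (Fin 2) E)).comp hurwitzGroup.subtype

end

/-!
If the reduction of one integral form is irreducible, a primitive intertwiner into any other form
is nonzero modulo the maximal ideal, hence bijective there, so the form is unique. When `2` is a
unit, the anticommuting reductions of `u` and `v` have no common eigenvector. Over an extension of
`ℚ_2` without primitive cube roots of unity, the reduction of `w` has no eigenvector at all, since
Krasner's lemma would lift a root of `x ^ 2 + x + 1` from the residue field.

If `E / ℚ_2` contains a primitive cube root of unity, every form is conjugate to one with `w`
diagonal. Then the diagonal of `u` is determined and its off-diagonal entries `q`, `r` satisfy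
`3 * q * r = -2`. Two such forms are equivalent iff their `q` are associated, and `q` can be any
divisor of `2`, so the classes correspond to the valuations in `[v(2), 1]`, while `(v(2), 1]`
represents the value group of `E` modulo that of `ℚ_2`.

The algebra splits as soon as `-1` is a sum of two squares in `E`. This holds in `ℤ_p` for odd `p`,
and in every quadratic extension `ℚ_2(√d)`: as `-d` is a sum of three squares in `ℚ_2`, zero is a
nontrivial sum of four squares there.
-/

noncomputable section

/-! ### Integral forms and their reductions -/

section

open Matrix IsLocalRing

theorem exists_eq_smul_algebraMap_comp {R K ι : Type*} [CommRing R] [IsDomain R] [ValuationRing R]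
    [Field K] [Algebra R K] [IsFractionRing R K] [Finite ι] {v : ι → K} (hv : v ≠ 0) :
    ∃ c : K, c ≠ 0 ∧ ∃ w : ι → R, v = c • (algebraMap R K ∘ w) ∧ ∃ i, w i = 1 := by
  obtain ⟨j, hj⟩ := Function.ne_iff.mp hv
  have : Nonempty ι := ⟨j⟩
  obtain ⟨i, hi⟩ := Finite.exists_max fun i => ValuationRing.valuation R K (v i)
  have hvi : v i ≠ 0 := fun h => hj (by simpa [h] using hi j)
  have hint : ∀ j, ∃ r : R, algebraMap R K r = v j / v i := fun j => by
    rw [← ValuationRing.mem_integer_iff, Valuation.mem_integer_iff, map_div₀]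
    exact div_le_one_of_le₀ (hi j) zero_le
  choose w hw using hint
  refine ⟨v i, hvi, w, ?_, i, FaithfulSMul.algebraMap_injective R K ?_⟩
  · ext j
    simp [hw, mul_div_cancel₀, hvi]
  · rw [hw, div_self hvi, map_one]

/-- A stable line is spanned by a common eigenvector. -/
theorem isIrreducible_of_finrank_eq_two {k G V : Type*} [Field k] [Group G] [AddCommGroup V]
    [Module k V] (hV : Module.finrank k V = 2) {ρ : Representation k G V}
    (hρ : ∀ v ≠ 0, ∃ g, ∀ c : k, ρ g v ≠ c • v) : ρ.IsIrreducible := by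
  have : Module.Finite k V := Module.finite_of_finrank_eq_succ hV
  have : Nontrivial V := Module.nontrivial_of_finrank_eq_succ hV
  have hbot : (⊥ : Subrepresentation ρ).toSubmodule = ⊥ := rfl
  have htop : (⊤ : Subrepresentation ρ).toSubmodule = ⊤ := rfl
  refine { exists_pair_ne := ⟨⊥, ⊤, fun h => bot_ne_top
             (congrArg Subrepresentation.toSubmodule h)⟩, eq_bot_or_eq_top := fun W => ?_ }
  rw [← Subrepresentation.toSubmodule_injective.eq_iff,
    ← Subrepresentation.toSubmodule_injective.eq_iff, hbot, htop]
  by_contra! hW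
  obtain ⟨w, hwW, hw⟩ := W.toSubmodule.ne_bot_iff.mp hW.1
  have hlt := Submodule.finrank_lt hW.2
  have hdim : Module.finrank k W.toSubmodule = 1 := by
    have := Submodule.one_le_finrank_iff.mpr hW.1
    omega
  obtain ⟨g, hg⟩ := hρ w hw
  obtain ⟨c, hc⟩ := (finrank_eq_one_iff_of_nonzero' (⟨w, hwW⟩ : W.toSubmodule)
    (by simpa using hw)).mp hdim ⟨ρ g w, W.apply_mem_toSubmodule g hwW⟩
  exact hg c (congrArg Subtype.val hc).symm

namespace IntegralRep


section Conjugation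

variable {R K : Type*} [CommRing R] [Field K] [Algebra R K] {G : Type*} [Group G] {n : ℕ}
  {ρ : G →* GL (Fin n) K}

/-- The conjugate `h⁻¹ ρ' h` of an integral representation `ρ'` by an element `h` of `GL_n(R)`. -/
def conj (ρ' : IntegralRep R ρ) (h : GL (Fin n) R) : IntegralRep R ρ :=
  ⟨(MulAut.conj h⁻¹).toMonoidHom.comp ρ'.1, by
    obtain ⟨g, hg⟩ := ρ'.2
    refine ⟨(GeneralLinearGroup.map (algebraMap R K) h)⁻¹ * g, fun x => ?_⟩
    simp only [MonoidHom.comp_apply, MulEquiv.coe_toMonoidHom, MulAut.conj_apply, inv_inv, map_mul,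
      hg]
    rw [map_inv]
    group⟩

theorem equiv_conj (ρ' : IntegralRep R ρ) (h : GL (Fin n) R) :
    integralRepSetoid R ρ ρ' (ρ'.conj h) :=
  ⟨h⁻¹, fun _ => by simp [conj]⟩

theorem conj_val_eq (ρ' : IntegralRep R ρ) (h : GL (Fin n) R) {x : G} {A : Matrix (Fin n) (Fin n) R}
    (hx : (ρ'.1 x).val * h.val = h.val * A) : ((ρ'.conj h).1 x).val = A := by
  have hconj : (ρ'.conj h).1 x = h⁻¹ * ρ'.1 x * h := by simp [conj]
  rw [hconj, mul_assoc, Units.val_mul, Units.val_mul, hx, Units.inv_mul_cancel_left]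

theorem exists_intertwiner (ρ₁ ρ₂ : IntegralRep R ρ) : ∃ z : GL (Fin n) K, ∀ x,
    (ρ₂.1 x).val.map (algebraMap R K) * z.val = z.val * (ρ₁.1 x).val.map (algebraMap R K) := by
  obtain ⟨g₁, h₁⟩ := ρ₁.2
  obtain ⟨g₂, h₂⟩ := ρ₂.2
  refine ⟨g₂ * g₁⁻¹, fun x => ?_⟩
  have h : GeneralLinearGroup.map (algebraMap R K) (ρ₂.1 x) * (g₂ * g₁⁻¹) =
      (g₂ * g₁⁻¹) * GeneralLinearGroup.map (algebraMap R K) (ρ₁.1 x) := by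
    rw [h₁, h₂]; group
  exact congrArg Units.val h

theorem equiv_of_intertwiner {ρ₁ ρ₂ : IntegralRep R ρ} (h : GL (Fin n) R)
    (hh : ∀ x, (ρ₂.1 x).val * h.val = h.val * (ρ₁.1 x).val) : integralRepSetoid R ρ ρ₁ ρ₂ :=
  ⟨h, fun x => eq_mul_inv_of_mul_eq (Units.ext (hh x))⟩

theorem equiv_of_closure_eq_top {s : Set G} (hs : Subgroup.closure s = ⊤) {ρ₁ ρ₂ : IntegralRep R ρ}
    (h : GL (Fin n) R) (hh : ∀ x ∈ s, (ρ₂.1 x).val * h.val = h.val * (ρ₁.1 x).val) :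
    integralRepSetoid R ρ ρ₁ ρ₂ :=
  ⟨h, DFunLike.congr_fun (f := ρ₂.1) (g := (MulAut.conj h).toMonoidHom.comp ρ₁.1)
    (MonoidHom.eq_of_eqOn_dense hs fun x hx => eq_mul_inv_of_mul_eq (Units.ext (hh x hx)))⟩

theorem exists_map_eq_conj [FaithfulSMul R K] (z : GL (Fin n) K)
    (hz : ∀ x, z * ρ x * z⁻¹ ∈ (GeneralLinearGroup.map (n := Fin n) (algebraMap R K)).range) :
    ∃ ρ' : IntegralRep R ρ, ∀ x,
      GeneralLinearGroup.map (algebraMap R K) (ρ'.1 x) = z * ρ x * z⁻¹ := by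
  have hinj : Function.Injective (GeneralLinearGroup.map (n := Fin n) (algebraMap R K)) :=
    fun a b hab => Units.ext
      (map_injective (FaithfulSMul.algebraMap_injective R K) (congrArg Units.val hab))
  let φ : G →* GL (Fin n) R := (MonoidHom.ofInjective hinj).symm.toMonoidHom.comp
    (((MulAut.conj z).toMonoidHom.comp ρ).codRestrict _ hz)
  have hφ : ∀ x, GeneralLinearGroup.map (algebraMap R K) (φ x) = z * ρ x * z⁻¹ := fun x =>
    congrArg Subtype.val ((MonoidHom.ofInjective hinj).apply_symm_apply ⟨_, hz x⟩)
  exact ⟨⟨φ, z, hφ⟩, hφ⟩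

theorem exists_val_eq_of_closure_eq_top [FaithfulSMul R K] {ι : Type*} {s : ι → G}
    (hs : Subgroup.closure (Set.range s) = ⊤) (ρ₀ : IntegralRep R ρ) (z : GL (Fin n) K)
    (A : ι → Matrix (Fin n) (Fin n) R)
    (hA : ∀ i, (A i).map (algebraMap R K) * z.val =
      z.val * (ρ₀.1 (s i)).val.map (algebraMap R K)) :
    ∃ ρ' : IntegralRep R ρ, ∀ i, (ρ'.1 (s i)).val = A i := by
  obtain ⟨g, hg⟩ := ρ₀.2
  have hinj := FaithfulSMul.algebraMap_injective R K
  have hdet : ∀ i, IsUnit (A i).det := fun i => by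
    have h := congrArg det (hA i)
    simp only [det_mul, mul_comm z.val.det, ← RingHom.mapMatrix_apply, ← RingHom.map_det] at h
    rw [hinj (mul_right_cancel₀ (isUnits_det_units z).ne_zero h)]
    exact isUnits_det_units _
  have hconj : ∀ i, GeneralLinearGroup.map (algebraMap R K)
      (GeneralLinearGroup.mk'' (A i) (hdet i)) = z * g * ρ (s i) * (z * g)⁻¹ := fun i => by
    have h : GeneralLinearGroup.map (algebraMap R K) (GeneralLinearGroup.mk'' (A i) (hdet i)) * z =
      z * GeneralLinearGroup.map (algebraMap R K) (ρ₀.1 (s i)) := Units.ext (hA i)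
    rw [eq_mul_inv_of_mul_eq h, hg]
    group
  have hrange : ∀ x, z * g * ρ x * (z * g)⁻¹ ∈
      (GeneralLinearGroup.map (n := Fin n) (algebraMap R K)).range := by
    have hle : Subgroup.closure (Set.range s) ≤
        (GeneralLinearGroup.map (n := Fin n) (algebraMap R K)).range.comap
          ((MulAut.conj (z * g)).toMonoidHom.comp ρ) := by
      rw [Subgroup.closure_le]
      rintro _ ⟨i, rfl⟩
      exact ⟨_, hconj i⟩
    exact fun x => hle (hs ▸ Subgroup.mem_top x)
  obtain ⟨ρ', hρ'⟩ := exists_map_eq_conj (z * g) hrange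
  refine ⟨ρ', fun i => map_injective hinj ?_⟩
  exact congrArg Units.val ((hρ' (s i)).trans (hconj i).symm)

end Conjugation

section Existence

variable {R K : Type*} [CommRing R] [Field K] [Algebra R K] {G : Type*} [Group G] {n : ℕ}

theorem nonempty_of_forall_mem_range [FaithfulSMul R K] {ρ : G →* GL (Fin n) K} (z : GL (Fin n) K)
    (hz : ∀ x i j, (z * ρ x * z⁻¹).val i j ∈ (algebraMap R K).range) :
    Nonempty (IntegralRep R ρ) := by
  refine ⟨(exists_map_eq_conj z fun x => ?_).choose⟩
  choose A hA using hz
  have hmul : ∀ x y, x * y = 1 → of (A x) * of (A y) = 1 := fun x y hxy => by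
    refine map_injective (FaithfulSMul.algebraMap_injective R K) ?_
    have hA' : ∀ x, (of (A x)).map (algebraMap R K) = (z * ρ x * z⁻¹).val := fun x => ext (hA x)
    change (of (A x) * of (A y)).map (algebraMap R K) = (1 : Matrix _ _ R).map (algebraMap R K)
    rw [Matrix.map_mul, hA', hA', ← Units.val_mul,
      show z * ρ x * z⁻¹ * (z * ρ y * z⁻¹) = z * ρ (x * y) * z⁻¹ by rw [map_mul]; group, hxy]
    simp
  exact ⟨⟨of (A x), of (A x⁻¹), hmul _ _ (mul_inv_cancel x), hmul _ _ (inv_mul_cancel x)⟩,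
    Units.ext (ext (hA x))⟩

theorem exists_basis_span_eq [IsDomain R] [ValuationRing R] [IsFractionRing R K] {V ι : Type*}
    [AddCommGroup V] [Module K V] [Module R V] [IsScalarTower R K V] (e : Module.Basis ι K V)
    (M : Submodule R V) [Submodule.IsLattice K M] :
    ∃ b : Module.Basis ι K V, Submodule.span R (Set.range b) = M := by
  have : Module.IsTorsionFree R V := Module.IsTorsionFree.trans_faithfulSMul R K V
  have : Module.Flat R M := Module.Flat.flat_iff_torsion_eq_bot_of_isBezout.mpr
    (Submodule.isTorsionFree_iff_torsion_eq_bot.mp inferInstance)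
  have : Module.Free R M := Module.free_of_flat_of_isLocalRing
  let c := Module.Free.chooseBasis R M
  refine ⟨(c.extendOfIsLattice K).reindex ((c.extendOfIsLattice K).indexEquiv e), ?_⟩
  have hrange : Set.range (c.extendOfIsLattice K) = M.subtype '' Set.range c := by
    rw [← Set.range_comp]
    exact congrArg Set.range (funext fun i => c.extendOfIsLattice_apply K i)
  rw [Module.Basis.range_reindex, hrange, Submodule.span_image, c.span_eq,
    Submodule.map_subtype_top]

theorem nonempty_of_isLattice [IsDomain R] [ValuationRing R] [IsFractionRing R K]
    {ρ : G →* GL (Fin n) K} (M : Submodule R (Fin n → K)) [Submodule.IsLattice K M]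
    (hM : ∀ x, ∀ v ∈ M, (ρ x).val *ᵥ v ∈ M) : Nonempty (IntegralRep R ρ) := by
  let e := Pi.basisFun K (Fin n)
  obtain ⟨b, hb⟩ := exists_basis_span_eq e M
  let z : GL (Fin n) K :=
    ⟨b.toMatrix e, e.toMatrix b, b.toMatrix_mul_toMatrix_flip e, e.toMatrix_mul_toMatrix_flip b⟩
  have hz : ∀ x, (z * ρ x * z⁻¹).val = LinearMap.toMatrix b b (toLin' (ρ x).val) := fun x => by
    rw [← basis_toMatrix_mul_linearMap_toMatrix_mul_basis_toMatrix b e b e, ← toLin_eq_toLin',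
      LinearMap.toMatrix_toLin]
    rfl
  refine nonempty_of_forall_mem_range z fun x i j => ?_
  have hmem : (ρ x).val *ᵥ b j ∈ Submodule.span R (Set.range b) := by
    rw [hb]
    exact hM x _ (hb ▸ Submodule.subset_span ⟨j, rfl⟩)
  rw [hz, LinearMap.toMatrix_apply, toLin'_apply]
  exact (b.mem_span_iff_repr_mem R _).mp hmem i

/-- A finite group stabilises the lattice generated by the orbit of a basis. -/
theorem nonempty_of_finite [IsDomain R] [ValuationRing R] [IsFractionRing R K] [Finite G]
    (ρ : G →* GL (Fin n) K) : Nonempty (IntegralRep R ρ) := by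
  let orbit : G × Fin n → Fin n → K := fun y => (ρ y.1).val *ᵥ Pi.single y.2 1
  have : Submodule.IsLattice K (Submodule.span R (Set.range orbit)) :=
    { fg := Submodule.fg_span (Set.finite_range orbit)
      span_eq_top := by
        rw [Submodule.span_span_of_tower, eq_top_iff, ← (Pi.basisFun K (Fin n)).span_eq]
        refine Submodule.span_mono ?_
        rintro _ ⟨i, rfl⟩
        exact ⟨(1, i), by simp [orbit, -mulVec_single]⟩ }
  refine nonempty_of_isLattice (Submodule.span R (Set.range orbit)) fun x => ?_
  suffices hle : Submodule.span R (Set.range orbit) ≤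
      (Submodule.span R (Set.range orbit)).comap ((mulVecLin (ρ x).val).restrictScalars R) from hle
  rw [Submodule.span_le]
  rintro _ ⟨⟨y, i⟩, rfl⟩
  exact Submodule.subset_span ⟨(x * y, i), by simp [orbit, -mulVec_single, mulVec_mulVec]⟩

end Existence

section Reduction

/-- The reduction of an integral representation modulo the maximal ideal, as a linear
representation over the residue field; its irreducibility forces the integral form to be unique. -/
def residual {R K : Type*} [CommRing R] [IsLocalRing R] [Field K] [Algebra R K] {G : Type*}
    [Group G] {n : ℕ} {ρ : G →* GL (Fin n) K} (ρ' : IntegralRep R ρ) :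
    Representation (ResidueField R) G (Fin n → ResidueField R) :=
  (toLinAlgEquiv' : _ ≃ₐ[ResidueField R] _).toMonoidHom.comp
    ((Units.coeHom _).comp ((GeneralLinearGroup.map (residue R)).comp ρ'.1))

theorem residual_apply {R K : Type*} [CommRing R] [IsLocalRing R] [Field K] [Algebra R K]
    {G : Type*} [Group G] {n : ℕ} {ρ : G →* GL (Fin n) K} (ρ' : IntegralRep R ρ) (x : G)
    (v : Fin n → ResidueField R) :
    ρ'.residual x v = (residue R).mapMatrix (ρ'.1 x).val *ᵥ v :=
  rfl

variable {R K : Type*} [CommRing R] [IsDomain R] [ValuationRing R] [Field K] [Algebra R K]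
  [IsFractionRing R K] {G : Type*} [Group G] {n : ℕ} {ρ : G →* GL (Fin n) K}

theorem exists_primitive_intertwiner [NeZero n] (ρ₁ ρ₂ : IntegralRep R ρ) :
    ∃ A : Matrix (Fin n) (Fin n) R, (∃ i j, A i j = 1) ∧
      ∀ x, (ρ₂.1 x).val * A = A * (ρ₁.1 x).val := by
  obtain ⟨z, hz⟩ := exists_intertwiner ρ₁ ρ₂
  have hz0 : (fun ij : Fin n × Fin n => z.val ij.1 ij.2) ≠ 0 := fun h =>
    z.ne_zero (ext fun i j => congrFun h (i, j))
  obtain ⟨c, hc, w, hw, ⟨i, j⟩, hij⟩ := exists_eq_smul_algebraMap_comp (R := R) hz0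
  let A : Matrix (Fin n) (Fin n) R := of fun i j => w (i, j)
  have hzA : z.val = c • A.map (algebraMap R K) := ext fun i j => congrFun hw (i, j)
  refine ⟨A, ⟨i, j, hij⟩, fun x => map_injective (FaithfulSMul.algebraMap_injective R K) ?_⟩
  have h := hz x
  rw [hzA, Matrix.mul_smul, Matrix.smul_mul, ← Matrix.map_mul, ← Matrix.map_mul] at h
  exact smul_right_injective _ hc h

/-- A primitive intertwiner has nonzero reduction, which is injective by irreducibility. -/
theorem equiv_of_isIrreducible_residual (ρ₁ ρ₂ : IntegralRep R ρ)
    (h₁ : ρ₁.residual.IsIrreducible) : integralRepSetoid R ρ ρ₁ ρ₂ := by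
  rcases eq_zero_or_neZero n with rfl | _
  · exact ⟨1, fun x => Units.ext (Subsingleton.elim _ _)⟩
  obtain ⟨A, ⟨i, j, hij⟩, hA⟩ := exists_primitive_intertwiner ρ₁ ρ₂
  let a : Representation.IntertwiningMap ρ₁.residual ρ₂.residual :=
    { toLinearMap := toLin' (A.map (residue R))
      isIntertwining' := fun x => by
        have h := congrArg (fun B => toLin' (B.map (residue R))) (hA x)
        simp only [Matrix.map_mul, toLin'_mul] at h
        exact h.symm }
  have ha : a ≠ 0 := fun h => by
    have h0 : A.map (residue R) = 0 :=
      toLin'.injective ((congrArg (·.toLinearMap) h).trans (map_zero toLin').symm)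
    simpa [hij] using congrFun₂ h0 i j
  have hinj : Function.Injective (A.map (residue R)).mulVec :=
    (h₁.injective_or_eq_zero a).resolve_right ha
  have hdet : IsUnit A.det := by
    rw [← isUnit_map_iff (residue R), RingHom.map_det, ← isUnit_iff_isUnit_det]
    exact mulVec_injective_iff_isUnit.mp hinj
  exact equiv_of_intertwiner (GeneralLinearGroup.mk'' A hdet) hA

theorem card_integralForms_eq_one_of_isIrreducible_residual [Finite G]
    (hρ : ∀ ρ' : IntegralRep R ρ, ρ'.residual.IsIrreducible) :
    ENat.card (IntegralForms R ρ) = 1 := by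
  have : Nonempty (IntegralForms R ρ) := (nonempty_of_finite ρ).map (Quotient.mk _)
  have : Subsingleton (IntegralForms R ρ) := ⟨fun a b => Quotient.inductionOn₂ a b fun ρ₁ ρ₂ =>
    Quotient.sound (equiv_of_isIrreducible_residual ρ₁ ρ₂ (hρ ρ₁))⟩
  exact ENat.card_eq_one_iff_unique.mpr
    ((unique_iff_subsingleton_and_nonempty _).mpr ⟨inferInstance, inferInstance⟩)

end Reduction
end IntegralRep

/-! ### The Hurwitz group -/

/-- The Hurwitz order `ℤ + ℤ𝐮 + ℤ𝐯 + ℤ(1 + 𝐮 + 𝐯 + 𝐮𝐯)/2` in `𝔄`, whose integrality bounds the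
denominators of the elements of the Hurwitz group. -/
def hurwitzOrder : Subring ℍ[ℚ] where
  carrier := {q | ∃ a b c d : ℤ,
    q.re = a + d / 2 ∧ q.imI = b + d / 2 ∧ q.imJ = c + d / 2 ∧ q.imK = d / 2}
  zero_mem' := ⟨0, 0, 0, 0, by simp⟩
  one_mem' := ⟨1, 0, 0, 0, by simp⟩
  add_mem' := by
    rintro p q ⟨a, b, c, d, hp⟩ ⟨a', b', c', d', hq⟩
    refine ⟨a + a', b + b', c + c', d + d', ?_, ?_, ?_, ?_⟩ <;>
      simp only [Quaternion.re_add, Quaternion.imI_add, Quaternion.imJ_add, Quaternion.imK_add, hp,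
        hq, Int.cast_add] <;> ring
  neg_mem' := by
    rintro p ⟨a, b, c, d, hp⟩
    refine ⟨-a, -b, -c, -d, ?_, ?_, ?_, ?_⟩ <;>
      simp only [Quaternion.re_neg, Quaternion.imI_neg, Quaternion.imJ_neg, Quaternion.imK_neg, hp,
        Int.cast_neg] <;> ring
  mul_mem' := by
    rintro p q ⟨a, b, c, d, hp⟩ ⟨a', b', c', d', hq⟩
    refine ⟨a * a' - b * b' - c * c' - b * c' + c * b' - d * d' - b * d' - d * c',
      a * b' + b * a' - b * c' + c * b' + d * b' + c * d' - d * c',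
      a * c' + c * a' - b * c' + c * b' - b * d' + c * d' + d * b',
      a * d' + d * a' + b * d' + d * c' - c * d' - d * b' + d * d' + 2 * (b * c' - c * b'),
      ?_, ?_, ?_, ?_⟩ <;>
      simp only [Quaternion.re_mul, Quaternion.imI_mul, Quaternion.imJ_mul, Quaternion.imK_mul, hp,
        hq, Int.cast_sub, Int.cast_add, Int.cast_mul, Int.cast_ofNat] <;> ring

theorem hurwitzU_coords : hurwitzU.val.re = 0 ∧ hurwitzU.val.imI = 1 ∧ hurwitzU.val.imJ = 0 ∧
    hurwitzU.val.imK = 0 :=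
  ⟨rfl, rfl, rfl, rfl⟩

theorem hurwitzV_coords : hurwitzV.val.re = 0 ∧ hurwitzV.val.imI = 0 ∧ hurwitzV.val.imJ = 1 ∧
    hurwitzV.val.imK = 0 :=
  ⟨rfl, rfl, rfl, rfl⟩

theorem hurwitzW_coords : hurwitzW.val.re = -1 / 2 ∧ hurwitzW.val.imI = 1 / 2 ∧
    hurwitzW.val.imJ = 1 / 2 ∧ hurwitzW.val.imK = 1 / 2 :=
  ⟨rfl, rfl, rfl, rfl⟩

namespace hurwitzGroup

theorem mem_hurwitzOrder_and_normSq_eq_one (x : hurwitzGroup) :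
    x.1.val ∈ hurwitzOrder ∧ Quaternion.normSq x.1.val = 1 := by
  have hle : hurwitzGroup ≤ hurwitzOrder.toSubmonoid.units ⊓
      (Units.map (Quaternion.normSq : ℍ[ℚ] →*₀ ℚ).toMonoidHom).ker := by
    refine (Subgroup.closure_le _).mpr ?_
    rintro _ (rfl | rfl | rfl)
    · refine ⟨⟨⟨-1, 0, 0, 1, ?_⟩, ⟨0, 0, 0, -1, ?_⟩⟩, Units.ext ?_⟩ <;>
        norm_num [Quaternion.inv_def, hurwitzW_coords, Quaternion.normSq_def']
    · refine ⟨⟨⟨0, 1, 0, 0, ?_⟩, ⟨0, -1, 0, 0, ?_⟩⟩, Units.ext ?_⟩ <;>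
        norm_num [Quaternion.inv_def, hurwitzU_coords, Quaternion.normSq_def']
    · refine ⟨⟨⟨0, 0, 1, 0, ?_⟩, ⟨0, 0, -1, 0, ?_⟩⟩, Units.ext ?_⟩ <;>
        norm_num [Quaternion.inv_def, hurwitzV_coords, Quaternion.normSq_def']
  exact ⟨(hle x.2).1.1, congrArg Units.val (hle x.2).2⟩

/-- A Hurwitz unit has coordinates in `½ℤ ∩ [-1, 1]`. -/
instance : Finite hurwitzGroup := by
  let box : Set (ℤ × ℤ × ℤ × ℤ) := Set.Icc (-2, -2, -2, -2) (2, 2, 2, 2)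
  have hcoords : ∀ x : hurwitzGroup, ∃ t : box,
      x.1.val.re = t.1.1 / 2 ∧ x.1.val.imI = t.1.2.1 / 2 ∧
        x.1.val.imJ = t.1.2.2.1 / 2 ∧ x.1.val.imK = t.1.2.2.2 / 2 := fun x => by
    obtain ⟨⟨a, b, c, d, hq⟩, hnorm⟩ := mem_hurwitzOrder_and_normSq_eq_one x
    have hsum : (2 * a + d) ^ 2 + (2 * b + d) ^ 2 + (2 * c + d) ^ 2 + d ^ 2 = 4 := by
      rw [Quaternion.normSq_def', hq.1, hq.2.1, hq.2.2.1, hq.2.2.2] at hnorm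
      have : ((2 * a + d) ^ 2 + (2 * b + d) ^ 2 + (2 * c + d) ^ 2 + d ^ 2 : ℚ) = 4 := by
        linear_combination 4 * hnorm
      exact_mod_cast this
    refine ⟨⟨(2 * a + d, 2 * b + d, 2 * c + d, d), ?_⟩, ?_⟩
    · simp only [box, Set.mem_Icc, Prod.mk_le_mk]
      refine ⟨⟨?_, ?_, ?_, ?_⟩, ?_, ?_, ?_, ?_⟩ <;> nlinarith
    · simp only [hq, Int.cast_add, Int.cast_mul, Int.cast_ofNat, and_true]
      refine ⟨?_, ?_, ?_⟩ <;> ring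
  choose t ht using hcoords
  refine Finite.of_injective t fun x y hxy => Subtype.ext (Units.ext ?_)
  have hx := ht x
  rw [hxy] at hx
  ext
  · exact hx.1.trans (ht y).1.symm
  · exact hx.2.1.trans (ht y).2.1.symm
  · exact hx.2.2.1.trans (ht y).2.2.1.symm
  · exact hx.2.2.2.trans (ht y).2.2.2.symm

/-- `𝐮` as an element of the Hurwitz group. -/
def u : hurwitzGroup := ⟨hurwitzU, Subgroup.subset_closure (by simp)⟩

/-- `𝐯` as an element of the Hurwitz group. -/
def v : hurwitzGroup := ⟨hurwitzV, Subgroup.subset_closure (by simp)⟩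

/-- `𝐰` as an element of the Hurwitz group. -/
def w : hurwitzGroup := ⟨hurwitzW, Subgroup.subset_closure (by simp)⟩

theorem w_mul_v : w * v = u * w := by
  refine Subtype.ext (Units.ext ?_)
  change hurwitzW.val * hurwitzV.val = hurwitzU.val * hurwitzW.val
  ext <;> norm_num [hurwitzU_coords, hurwitzV_coords, hurwitzW_coords]

theorem closure_range_w_u : Subgroup.closure (Set.range ![w, u]) = ⊤ := by
  have hw : w ∈ Subgroup.closure (Set.range ![w, u]) := Subgroup.subset_closure ⟨0, rfl⟩
  have hu : u ∈ Subgroup.closure (Set.range ![w, u]) := Subgroup.subset_closure ⟨1, rfl⟩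
  have hgen := Subgroup.closure_closure_coe_preimage (k := {hurwitzW, hurwitzU, hurwitzV})
  refine top_le_iff.mp (hgen.ge.trans ((Subgroup.closure_le _).mpr ?_))
  rintro ⟨x, hx⟩ (rfl | rfl | rfl)
  · exact hw
  · exact hu
  · change v ∈ Subgroup.closure (Set.range ![w, u])
    rw [eq_inv_mul_of_mul_eq w_mul_v]
    exact mul_mem (inv_mem hw) (mul_mem hu hw)

end hurwitzGroup

section QuaternionMatrix

variable {K : Type*} [CommRing K] [Algebra ℚ K]

/-- The pure quaternions are sums of commutators. -/
theorem trace_algHom_quaternion {n : Type*} [Fintype n] [DecidableEq n]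
    (φ : ℍ[ℚ] →ₐ[ℚ] Matrix n n K) (q : ℍ[ℚ]) :
    (φ q).trace = Fintype.card n * algebraMap ℚ K q.re := by
  set i := hurwitzU.val
  set j := hurwitzV.val
  set k := i * j with hk
  have hq : q = algebraMap ℚ _ q.re + (q.imI / 2) • (j * k - k * j) +
      (q.imJ / 2) • (k * i - i * k) + (q.imK / 2) • (i * j - j * i) := by
    ext <;> simp [hk, i, j, hurwitzU_coords, hurwitzV_coords, one_add_one_eq_two]
  have hcomm : ∀ (c : ℚ) (x y : ℍ[ℚ]), (φ (c • (x * y - y * x))).trace = 0 := fun c x y => by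
    rw [map_smul, map_sub, map_mul, map_mul, trace_smul, trace_sub, trace_mul_comm, sub_self,
      smul_zero]
  conv_lhs => rw [hq]
  simp only [map_add, trace_add, hcomm, add_zero, AlgHom.commutes, algebraMap_eq_diagonal,
    trace_diagonal]
  simp

theorem det_algHom_quaternion (φ : ℍ[ℚ] →ₐ[ℚ] Matrix (Fin 2) (Fin 2) K) (q : ℍ[ℚ]) :
    (φ q).det = algebraMap ℚ K (Quaternion.normSq q) := by
  have hadj : φ (star q) = (φ q).adjugate := by
    have htr := trace_algHom_quaternion φ q
    rw [Fintype.card_fin, Nat.cast_ofNat, trace_fin_two] at htr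
    have hstar : star q = algebraMap ℚ _ (2 * q.re) - q := by ext <;> simp [two_mul]
    rw [hstar, map_sub, AlgHom.commutes, adjugate_fin_two, algebraMap_eq_diagonal,
      map_mul, map_ofNat]
    ext a b
    fin_cases a <;> fin_cases b <;> simp
    · linear_combination -htr
    · linear_combination -htr
  have h := congrArg φ (Quaternion.self_mul_star q)
  rw [map_mul, hadj, mul_adjugate, ← Quaternion.algebraMap_def, AlgHom.commutes] at h
  simpa [algebraMap_matrix_apply] using congrFun₂ h 0 0

end QuaternionMatrix

namespace IntegralRep

section Relations

variable {R E : Type*} [CommRing R] [Field E] [CharZero E] [Algebra R E] {f : HamiltonSplitting E}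

theorem exists_algHom (ρ' : IntegralRep R (hurwitzRep f)) :
    ∃ φ : ℍ[ℚ] →ₐ[ℚ] Matrix (Fin 2) (Fin 2) E, ∀ x : hurwitzGroup,
      (algebraMap R E).mapMatrix (ρ'.1 x).val = φ x.1.val := by
  obtain ⟨g, hg⟩ := ρ'.2
  let φ : ℍ[ℚ] →ₐ[ℚ] Matrix (Fin 2) (Fin 2) E :=
    (f.toAlgHom.restrictScalars ℚ).comp Algebra.TensorProduct.includeRight
  refine ⟨(MulSemiringAction.toAlgHom ℚ _ (ConjAct.toConjAct g)).comp φ, fun x => ?_⟩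
  exact congrArg Units.val (hg x)

variable [FaithfulSMul R E] (ρ' : IntegralRep R (hurwitzRep f))

theorem trace_val_eq (x : hurwitzGroup) {t : ℤ} (ht : 2 * x.1.val.re = t) :
    (ρ'.1 x).val.trace = t := by
  obtain ⟨φ, hφ⟩ := ρ'.exists_algHom
  apply FaithfulSMul.algebraMap_injective R E
  have h := trace_algHom_quaternion φ x.1.val
  rw [← hφ, Fintype.card_fin, Nat.cast_ofNat, ← map_ofNat (algebraMap ℚ E), ← map_mul, ht,
    map_intCast] at h
  rw [map_intCast, ← h, AddMonoidHom.map_trace]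
  rfl

theorem det_val_eq_one (x : hurwitzGroup) : (ρ'.1 x).val.det = 1 := by
  obtain ⟨φ, hφ⟩ := ρ'.exists_algHom
  apply FaithfulSMul.algebraMap_injective R E
  rw [RingHom.map_det, hφ, det_algHom_quaternion,
    (hurwitzGroup.mem_hurwitzOrder_and_normSq_eq_one x).2, map_one, map_one]

open hurwitzGroup

theorem trace_val_w : (ρ'.1 w).val.trace = -1 := by
  rw [ρ'.trace_val_eq w (t := -1) (by norm_num [w, hurwitzW_coords]), Int.cast_neg, Int.cast_one]

theorem trace_val_u : (ρ'.1 u).val.trace = 0 := by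
  rw [ρ'.trace_val_eq u (t := 0) (by norm_num [u, hurwitzU_coords]), Int.cast_zero]

theorem trace_val_w_mul_u : ((ρ'.1 w).val * (ρ'.1 u).val).trace = -1 := by
  rw [← Units.val_mul, ← map_mul, ρ'.trace_val_eq (w * u) (t := -1)
    (by norm_num [w, u, hurwitzW_coords, hurwitzU_coords]), Int.cast_neg, Int.cast_one]

theorem val_w_sq_add_val_w_add_one : (ρ'.1 w).val ^ 2 + (ρ'.1 w).val + 1 = 0 := by
  have htr := ρ'.trace_val_w
  have hdet := ρ'.det_val_eq_one w
  nontriviality R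
  simpa [charpoly_fin_two, htr, hdet] using aeval_self_charpoly (ρ'.1 w).val

theorem val_u_mul_val_v : (ρ'.1 u).val * (ρ'.1 v).val = -((ρ'.1 v).val * (ρ'.1 u).val) := by
  obtain ⟨φ, hφ⟩ := ρ'.exists_algHom
  have hq : u.1.val * v.1.val = -(v.1.val * u.1.val) := by
    ext <;> simp [u, v, hurwitzU_coords, hurwitzV_coords]
  apply map_injective (FaithfulSMul.algebraMap_injective R E)
  change (algebraMap R E).mapMatrix _ = (algebraMap R E).mapMatrix _
  rw [map_neg, map_mul, map_mul, hφ, hφ, ← map_mul, ← map_mul, ← map_neg, hq]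

end Relations

section IrreducibleReduction

variable {R E : Type*} [CommRing R] [IsLocalRing R] [Field E] [CharZero E] [Algebra R E]
  [FaithfulSMul R E] {f : HamiltonSplitting E} (ρ' : IntegralRep R (hurwitzRep f))

open hurwitzGroup

/-- The anticommuting `u` and `v` have no common eigenvector. -/
theorem isIrreducible_residual_of_isUnit_two (h2 : IsUnit (2 : R)) : ρ'.residual.IsIrreducible := by
  refine isIrreducible_of_finrank_eq_two (by simp) fun x hx => ?_
  by_contra! hev
  obtain ⟨a, ha⟩ := hev u
  obtain ⟨b, hb⟩ := hev v
  have hne : ∀ g, ρ'.residual g x ≠ 0 := fun g hg =>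
    hx (by simpa using congrArg (ρ'.residual g⁻¹) hg)
  have ha0 : a ≠ 0 := by rintro rfl; exact hne u (by simpa using ha)
  have hb0 : b ≠ 0 := by rintro rfl; exact hne v (by simpa using hb)
  have h2' : (2 : ResidueField R) ≠ 0 := by
    simpa only [map_ofNat] using (h2.map (residue R)).ne_zero
  have h : (2 * (a * b)) • x = 0 := by
    have h := congrArg ((residue R).mapMatrix · *ᵥ x) ρ'.val_u_mul_val_v
    simp only [map_mul, map_neg, neg_mulVec, ← mulVec_mulVec, ← residual_apply, ha, hb, map_smul,
      smul_smul] at h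
    rw [two_mul, add_smul, add_eq_zero_iff_eq_neg, ← h, mul_comm]
  exact hx ((smul_eq_zero.mp h).resolve_left (by simp [ha0, hb0, h2']))

theorem isIrreducible_residual_of_forall_ne_zero
    (hω : ∀ c : ResidueField R, c ^ 2 + c + 1 ≠ 0) : ρ'.residual.IsIrreducible := by
  refine isIrreducible_of_finrank_eq_two (by simp) fun x hx => ⟨w, fun c hc => ?_⟩
  have h := congrArg ((residue R).mapMatrix · *ᵥ x) ρ'.val_w_sq_add_val_w_add_one
  simp only [map_add, map_one, map_zero, sq, map_mul, add_mulVec, one_mulVec, zero_mulVec,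
    ← mulVec_mulVec, ← residual_apply, hc, map_smul, smul_smul] at h
  refine hx ((smul_eq_zero.mp (?_ : (c ^ 2 + c + 1) • x = 0)).resolve_left (hω c))
  rw [add_smul, add_smul, one_smul, sq, h]

end IrreducibleReduction
end IntegralRep

/-! ### Normal forms over a cube root of unity -/

theorem exists_mul_eq_mul_diagonal {R : Type*} [CommRing R] [IsLocalRing R]
    {A : Matrix (Fin 2) (Fin 2) R} {α β : R} (htr : A.trace = α + β) (hdet : A.det = α * β)
    (hαβ : IsUnit (α - β)) : ∃ h : GL (Fin 2) R, A * h.val = h.val * diagonal ![α, β] := by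
  suffices ∃ h : Matrix (Fin 2) (Fin 2) R, IsUnit h.det ∧ A * h = h * diagonal ![α, β] by
    obtain ⟨h, hunit, hh⟩ := this
    obtain ⟨h, rfl⟩ := (isUnit_iff_isUnit_det h).2 hunit
    exact ⟨h, hh⟩
  rw [trace_fin_two] at htr
  rw [det_fin_two] at hdet
  -- The columns of `A - β` are eigenvectors for `α`, those of `A - α` are eigenvectors for `β`.
  have hsum : IsUnit ((A 0 0 - β) + (A 1 1 - β)) := by
    rwa [show (A 0 0 - β) + (A 1 1 - β) = α - β by linear_combination htr]
  rcases isUnit_or_isUnit_of_isUnit_add hsum with hunit | hunit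
  · refine ⟨!![A 0 0 - β, A 0 1; A 1 0, A 1 1 - α], ?_, ?_⟩
    · convert (hunit.mul hαβ).neg using 1
      rw [det_fin_two_of]
      linear_combination hdet - β * htr
    · rw [eta_fin_two A]
      ext i j
      fin_cases i <;> fin_cases j <;> simp
      · linear_combination A 0 0 * htr - hdet
      · linear_combination A 0 1 * htr
      · linear_combination A 1 0 * htr
      · linear_combination A 1 1 * htr - hdet
  · refine ⟨!![A 0 1, A 0 0 - α; A 1 1 - β, A 1 0], ?_, ?_⟩
    · convert hunit.mul hαβ using 1
      rw [det_fin_two_of]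
      linear_combination -hdet + β * htr
    · rw [eta_fin_two A]
      ext i j
      fin_cases i <;> fin_cases j <;> simp
      · linear_combination A 0 1 * htr
      · linear_combination A 0 0 * htr - hdet
      · linear_combination A 1 1 * htr - hdet
      · linear_combination A 1 0 * htr

theorem valuation_integers (R E : Type*) [CommRing R] [IsDomain R] [ValuationRing R] [Field E]
    [Algebra R E] [IsFractionRing R E] : (ValuationRing.valuation R E).Integers R :=
  ⟨FaithfulSMul.algebraMap_injective R E,
    fun x => (ValuationRing.mem_integer_iff R E _).2 ⟨x, rfl⟩,
    fun x hx => (ValuationRing.mem_integer_iff R E x).1 hx⟩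

theorem card_quotient_eq_encard_image {α β : Type*} (s : Setoid α) (P : Set α) (F : α → β)
    (hP : ∀ a, ∃ b ∈ P, s a b) (hF : ∀ a ∈ P, ∀ b ∈ P, s a b ↔ F a = F b) :
    ENat.card (Quotient s) = (F '' P).encard := by
  have hsurj : Set.SurjOn (Quotient.mk s) P Set.univ := fun c _ => by
    obtain ⟨a, rfl⟩ := Quotient.exists_rep c
    obtain ⟨b, hb, hab⟩ := hP a
    exact ⟨b, hb, Quotient.sound (s.symm hab)⟩
  obtain ⟨Q, hQP, hQ⟩ := hsurj.exists_bijOn_subset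
  have hinj : Set.InjOn F Q := fun a ha b hb hab =>
    hQ.injOn ha hb (Quotient.sound ((hF a (hQP ha) b (hQP hb)).2 hab))
  have himage : F '' P = F '' Q := by
    refine (Set.image_mono hQP).antisymm' ?_
    rintro _ ⟨a, ha, rfl⟩
    obtain ⟨b, hb, hba⟩ := hQ.surjOn (Set.mem_univ (Quotient.mk s a))
    exact ⟨b, hb, (hF b (hQP hb) a ha).1 (Quotient.exact hba)⟩
  rw [← Set.encard_univ, ← hQ.image_eq, hQ.injOn.encard_image, himage, hinj.encard_image]

namespace IntegralRep

section CubeRoot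

open hurwitzGroup

variable {R E : Type*} [CommRing R] [Field E] [CharZero E] [Algebra R E] {f : HamiltonSplitting E}
  {ω : R}

variable (f ω) in
/-- The integral forms of `hurwitzRep f` in which `w` acts as the diagonal matrix with entries `ω`
and `-1 - ω`. When `ω` is a primitive cube root of unity they serve as normal forms, and the class
of such a form is governed by the upper right entry of the matrix of `u`. -/
def diagonalForms : Set (IntegralRep R (hurwitzRep f)) :=
  {ρ' | (ρ'.1 w).val = diagonal ![ω, -1 - ω]}

theorem isUnit_two_mul_add_one (hω : ω ^ 2 + ω + 1 = 0) (h3 : IsUnit (3 : R)) :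
    IsUnit (2 * ω + 1) :=
  isUnit_of_mul_isUnit_left (y := -(2 * ω + 1)) (by convert h3 using 1; linear_combination -4 * hω)

theorem associated_of_equiv (hω : ω ^ 2 + ω + 1 = 0) (h3 : IsUnit (3 : R))
    {ρ₁ ρ₂ : IntegralRep R (hurwitzRep f)} (h₁ : ρ₁ ∈ diagonalForms f ω)
    (h₂ : ρ₂ ∈ diagonalForms f ω) (h : integralRepSetoid R (hurwitzRep f) ρ₁ ρ₂) :
    Associated ((ρ₁.1 u).val 0 1) ((ρ₂.1 u).val 0 1) := by
  obtain ⟨h, hh⟩ := h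
  have hmul (x) : (ρ₂.1 x).val * h.val = h.val * (ρ₁.1 x).val :=
    congrArg Units.val (mul_eq_of_eq_mul_inv (hh x))
  have hw := hmul w
  rw [show (ρ₁.1 w).val = _ from h₁, show (ρ₂.1 w).val = _ from h₂] at hw
  have hs := isUnit_two_mul_add_one hω h3
  have h01 : h.val 0 1 = 0 := hs.mul_right_eq_zero.1 (by
    have h := congrFun₂ hw 0 1
    simp only [diagonal_mul, mul_diagonal, cons_val_zero, cons_val_one, cons_val_fin_one] at h
    linear_combination h)
  have hdet := h.isUnit
  rw [isUnit_iff_isUnit_det, det_fin_two, h01, zero_mul, sub_zero] at hdet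
  have hu : (ρ₂.1 u).val 0 1 * h.val 1 1 = h.val 0 0 * (ρ₁.1 u).val 0 1 := by
    simpa [mul_apply, h01] using congrFun₂ (hmul u) 0 1
  obtain ⟨a, ha⟩ := isUnit_of_mul_isUnit_left hdet
  obtain ⟨d, hd⟩ := isUnit_of_mul_isUnit_right hdet
  refine ⟨a * d⁻¹, ?_⟩
  rw [Units.val_mul, ha, ← mul_assoc, Units.mul_inv_eq_iff_eq_mul, hd, hu, mul_comm]

variable [FaithfulSMul R E]

theorem exists_mem_diagonalForms [IsLocalRing R] (hω : ω ^ 2 + ω + 1 = 0) (h3 : IsUnit (3 : R))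
    (ρ' : IntegralRep R (hurwitzRep f)) :
    ∃ ρ'' ∈ diagonalForms f ω, integralRepSetoid R (hurwitzRep f) ρ' ρ'' := by
  obtain ⟨h, hh⟩ := exists_mul_eq_mul_diagonal (A := (ρ'.1 w).val) (α := ω) (β := -1 - ω)
    (by rw [ρ'.trace_val_w]; ring)
    (by rw [ρ'.det_val_eq_one]; linear_combination hω)
    (by convert isUnit_two_mul_add_one hω h3 using 1; ring)
  exact ⟨ρ'.conj h, ρ'.conj_val_eq h hh, ρ'.equiv_conj h⟩

theorem val_u_one_one (ρ' : IntegralRep R (hurwitzRep f)) :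
     (ρ'.1 u).val 1 1 = -(ρ'.1 u).val 0 0 := by
  have htr := ρ'.trace_val_u
  rw [trace_fin_two] at htr
  linear_combination htr

section

variable {ρ' : IntegralRep R (hurwitzRep f)} (hρ' : ρ' ∈ diagonalForms f ω)
include hρ'

theorem mul_val_u_zero_zero : (2 * ω + 1) * (ρ'.1 u).val 0 0 = -1 := by
  have htr := ρ'.trace_val_w_mul_u
  rw [show (ρ'.1 w).val = _ from hρ', trace_fin_two] at htr
  simp only [diagonal_mul, cons_val_zero, cons_val_one, cons_val_fin_one, val_u_one_one] at htr
  linear_combination htr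

theorem three_mul_val_u (hω : ω ^ 2 + ω + 1 = 0) :
    3 * ((ρ'.1 u).val 0 1 * (ρ'.1 u).val 1 0) = -2 := by
  have hdet := ρ'.det_val_eq_one u
  rw [det_fin_two, val_u_one_one] at hdet
  have h00 := mul_val_u_zero_zero hρ'
  linear_combination -3 * hdet + ((2 * ω + 1) * (ρ'.1 u).val 0 0 - 1) * h00 -
    4 * (ρ'.1 u).val 0 0 ^ 2 * hω

end

theorem equiv_of_associated (hω : ω ^ 2 + ω + 1 = 0) (h3 : IsUnit (3 : R))
    {ρ₁ ρ₂ : IntegralRep R (hurwitzRep f)} (h₁ : ρ₁ ∈ diagonalForms f ω)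
    (h₂ : ρ₂ ∈ diagonalForms f ω) (h : Associated ((ρ₁.1 u).val 0 1) ((ρ₂.1 u).val 0 1)) :
    integralRepSetoid R (hurwitzRep f) ρ₁ ρ₂ := by
  have := (FaithfulSMul.algebraMap_injective R E).isDomain
  have := (algebraMap R E).charZero
  obtain ⟨c, hc⟩ := h
  have h00 : (ρ₂.1 u).val 0 0 = (ρ₁.1 u).val 0 0 :=
    (isUnit_two_mul_add_one hω h3).mul_left_cancel
      ((mul_val_u_zero_zero h₂).trans (mul_val_u_zero_zero h₁).symm)
  have h10 : (ρ₂.1 u).val 1 0 * c = (ρ₁.1 u).val 1 0 := by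
    have hqr := (three_mul_val_u h₂ hω).trans (three_mul_val_u h₁ hω).symm
    have hne : 3 * (ρ₁.1 u).val 0 1 ≠ 0 := fun h0 => by
      have hqr₁ := three_mul_val_u h₁ hω
      rw [← mul_assoc, h0, zero_mul, zero_eq_neg] at hqr₁
      exact two_ne_zero hqr₁
    exact mul_left_cancel₀ hne (by rw [← hc] at hqr; linear_combination hqr)
  refine equiv_of_closure_eq_top closure_range_w_u
    (GeneralLinearGroup.mk'' (diagonal ![(c : R), 1]) (by simp)) ?_
  rintro _ ⟨i, rfl⟩
  fin_cases i
  · change (ρ₂.1 w).val * diagonal _ = diagonal _ * (ρ₁.1 w).val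
    rw [show (ρ₁.1 w).val = _ from h₁, show (ρ₂.1 w).val = _ from h₂]
    exact commute_diagonal _ _
  · change (ρ₂.1 u).val * diagonal _ = diagonal _ * (ρ₁.1 u).val
    ext i j
    fin_cases i <;> fin_cases j <;>
      simp [val_u_one_one, h00, h10, ← hc, mul_comm]

theorem exists_mem_diagonalForms_val_u (hω : ω ^ 2 + ω + 1 = 0) {ρ₀ : IntegralRep R (hurwitzRep f)}
    (h₀ : ρ₀ ∈ diagonalForms f ω) {q r : R} (hqr : 3 * (q * r) = -2) :
    ∃ ρ' ∈ diagonalForms f ω, (ρ'.1 u).val 0 1 = q := by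
  set q₀ := algebraMap R E ((ρ₀.1 u).val 0 1) with hq₀_def
  set r₀ := algebraMap R E ((ρ₀.1 u).val 1 0) with hr₀_def
  have hqr₀ : 3 * (q₀ * r₀) = -2 := by
    simpa [map_ofNat (algebraMap R E)] using congrArg (algebraMap R E) (three_mul_val_u h₀ hω)
  have hqrE : 3 * (algebraMap R E q * algebraMap R E r) = -2 := by
    simpa [map_ofNat (algebraMap R E)] using congrArg (algebraMap R E) hqr
  have hq₀ : q₀ ≠ 0 := fun h0 => by norm_num [h0] at hqr₀
  have hq : algebraMap R E q ≠ 0 := fun h0 => by norm_num [h0] at hqrE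
  let z : GL (Fin 2) E := GeneralLinearGroup.mkOfDetNeZero
    (diagonal ![algebraMap R E q / q₀, 1]) (by simp [hq, hq₀])
  obtain ⟨ρ', hρ'⟩ := exists_val_eq_of_closure_eq_top closure_range_w_u ρ₀ z
    ![diagonal ![ω, -1 - ω], !![(ρ₀.1 u).val 0 0, q; r, -(ρ₀.1 u).val 0 0]] (by
      intro i
      fin_cases i
      · change (diagonal _).map _ * diagonal _ = diagonal _ * (ρ₀.1 w).val.map _
        rw [show (ρ₀.1 w).val = _ from h₀, diagonal_map (map_zero _)]
        exact commute_diagonal _ _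
      · change _ * diagonal _ = diagonal _ * (ρ₀.1 u).val.map _
        ext i j
        fin_cases i <;> fin_cases j <;>
          simp [val_u_one_one, mul_comm, ← hq₀_def, ← hr₀_def, mul_div_cancel₀ _ hq₀]
        field_simp
        linear_combination (hqrE - hqr₀) / 3)
  exact ⟨ρ', hρ' 0, congrFun₂ (hρ' 1) 0 1⟩

theorem image_val_u_diagonalForms (hω : ω ^ 2 + ω + 1 = 0) (h3 : IsUnit (3 : R))
    (h : (diagonalForms f ω).Nonempty) :
    (fun ρ' : IntegralRep R (hurwitzRep f) => (ρ'.1 u).val 0 1) '' diagonalForms f ω =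
      {q | q ∣ 2} := by
  obtain ⟨ρ₀, h₀⟩ := h
  obtain ⟨t, ht⟩ := h3.exists_right_inv
  ext q
  constructor
  · rintro ⟨ρ', hρ', rfl⟩
    exact ⟨-(3 * (ρ'.1 u).val 1 0), by linear_combination three_mul_val_u hρ' hω⟩
  · rintro ⟨r, hr⟩
    exact exists_mem_diagonalForms_val_u hω h₀ (q := q) (r := -(t * r))
      (by linear_combination hr - q * r * ht)

end CubeRoot

section ValuationRing

variable {R E : Type*} [CommRing R] [IsDomain R] [ValuationRing R] [Field E] [CharZero E]
  [Algebra R E] [IsFractionRing R E] {f : HamiltonSplitting E} {ω : R}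

theorem card_integralForms_eq_encard_Icc (hω : ω ^ 2 + ω + 1 = 0) (h3 : IsUnit (3 : R)) :
    ENat.card (IntegralForms R (hurwitzRep f)) =
      (Set.Icc (ValuationRing.valuation R E 2) 1).encard := by
  set v := ValuationRing.valuation R E
  have hv : v.Integers R := valuation_integers R E
  have hassoc (x y : R) : Associated x y ↔ v (algebraMap R E x) = v (algebraMap R E y) := by
    rw [← dvd_dvd_iff_associated, hv.dvd_iff_le, hv.dvd_iff_le, and_comm, le_antisymm_iff]
  have himage : Set.Icc (v 2) 1 = (v ∘ algebraMap R E) '' {q | q ∣ 2} := by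
    ext γ
    constructor
    · rintro ⟨h2, h1⟩
      obtain ⟨x, rfl⟩ := Quotient.mk_surjective γ
      obtain ⟨q, rfl⟩ := hv.exists_of_le_one h1
      exact ⟨q, hv.dvd_iff_le.2 (by rwa [map_ofNat]), rfl⟩
    · rintro ⟨q, hq, rfl⟩
      refine ⟨?_, hv.map_le_one q⟩
      rw [← map_ofNat (algebraMap R E)]
      exact hv.le_of_dvd hq
  obtain ⟨ρ'⟩ := nonempty_of_finite (R := R) (hurwitzRep f)
  obtain ⟨ρ₀, h₀, -⟩ := exists_mem_diagonalForms hω h3 ρ'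
  rw [himage, ← image_val_u_diagonalForms hω h3 ⟨ρ₀, h₀⟩, ← Set.image_comp]
  refine card_quotient_eq_encard_image _ _ _ (exists_mem_diagonalForms hω h3)
    fun ρ₁ h₁ ρ₂ h₂ => ?_
  exact Iff.trans ⟨associated_of_equiv hω h3 h₁ h₂, equiv_of_associated hω h3 h₁ h₂⟩ (hassoc _ _)

end ValuationRing

end IntegralRep

end

/-! ### The valuation of an algebraic extension of `ℚ_p` -/

section PadicIntegers

variable {p : ℕ} [Fact p.Prime] {E : Type*} [Field E] [Algebra ℚ_[p] E]

instance : IsFractionRing (PadicInt.subring p) ℚ_[p] :=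
  inferInstanceAs (IsFractionRing ℤ_[p] ℚ_[p])

instance : IsIntegrallyClosed (PadicInt.subring p) :=
  inferInstanceAs (IsIntegrallyClosed ℤ_[p])

theorem isUnit_natCast_padicIntegers {n : ℕ} (hn : n.Coprime p) :
    IsUnit (n : padicIntegers p E) := by
  have h : IsUnit (n : PadicInt.subring p) :=
    PadicInt.isUnit_iff.2 ((PadicInt.norm_natCast_eq_one_iff).2 hn.symm)
  simpa using h.map (algebraMap (PadicInt.subring p) (padicIntegers p E))

variable [Algebra.IsAlgebraic ℚ_[p] E]

theorem mem_padicIntegers_iff {x : E} : x ∈ padicIntegers p E ↔ spectralNorm ℚ_[p] E x ≤ 1 := by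
  have hx : IsIntegral ℚ_[p] x := Algebra.IsIntegral.isIntegral x
  rw [spectralNorm, spectralValue_le_one_iff (minpoly.monic hx)]
  constructor
  · intro hmem n
    rw [minpoly.isIntegrallyClosed_eq_field_fractions' ℚ_[p] hmem, Polynomial.coeff_map]
    exact ((minpoly (PadicInt.subring p) x).coeff n).2
  · intro hcoeff
    have hlifts : minpoly ℚ_[p] x ∈ Polynomial.lifts (algebraMap (PadicInt.subring p) ℚ_[p]) :=
      (Polynomial.lifts_iff_coeff_lifts _).2 fun n => ⟨⟨_, hcoeff n⟩, rfl⟩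
    obtain ⟨P, hP, -, hmonic⟩ :=
      Polynomial.lifts_and_degree_eq_and_monic hlifts (minpoly.monic hx)
    refine ⟨P, hmonic, ?_⟩
    rw [IsScalarTower.algebraMap_eq _ ℚ_[p] E, ← Polynomial.eval₂_map, hP]
    exact minpoly.aeval _ _

theorem exists_padicIntegers_eq_or_inv_eq (x : E) :
    ∃ a : padicIntegers p E, x = algebraMap _ E a ∨ x⁻¹ = algebraMap _ E a := by
  rcases le_total (spectralNorm ℚ_[p] E x) 1 with h | h
  · exact ⟨⟨x, mem_padicIntegers_iff.2 h⟩, Or.inl rfl⟩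
  · refine ⟨⟨x⁻¹, mem_padicIntegers_iff.2 ?_⟩, Or.inr rfl⟩
    rw [← spectralMulAlgNorm_def] at h ⊢
    rw [map_inv₀]
    exact inv_le_one_of_one_le₀ h

instance : IsFractionRing (padicIntegers p E) E :=
  isFractionRing_of_exists_eq_algebraMap_or_inv_eq_algebraMap_of_injective
   (exists_padicIntegers_eq_or_inv_eq (p := p)) (FaithfulSMul.algebraMap_injective _ _)

instance : ValuationRing (padicIntegers p E) :=
  (ValuationRing.iff_isInteger_or_isInteger _ E).2 fun x => by
    obtain ⟨a, ha | ha⟩ := exists_padicIntegers_eq_or_inv_eq (p := p) x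
    · exact Or.inl ⟨a, ha.symm⟩
    · exact Or.inr ⟨a, ha.symm⟩

variable (p) in
/-- The valuation of an algebraic extension of `ℚ_p` extending the `p`-adic one, written
multiplicatively, with values in its value group with zero. -/
abbrev padicValuation (E : Type*) [Field E] [Algebra ℚ_[p] E] [Algebra.IsAlgebraic ℚ_[p] E] :
    Valuation E (ValuationRing.ValueGroup (padicIntegers p E) E) :=
  ValuationRing.valuation (padicIntegers p E) E

theorem padicValuation_le_one_iff {x : E} :
    padicValuation p E x ≤ 1 ↔ spectralNorm ℚ_[p] E x ≤ 1 := by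
  rw [← mem_padicIntegers_iff, ← Valuation.mem_integer_iff, ValuationRing.mem_integer_iff]
  exact ⟨by rintro ⟨a, rfl⟩; exact a.2, fun h => ⟨⟨x, h⟩, rfl⟩⟩

theorem padicValuation_le_iff {x y : E} :
    padicValuation p E x ≤ padicValuation p E y ↔
      spectralNorm ℚ_[p] E x ≤ spectralNorm ℚ_[p] E y := by
  rcases eq_or_ne y 0 with rfl | hy
  · simp_rw [← spectralMulAlgNorm_def]
    rw [map_zero, map_zero, le_zero_iff, map_eq_zero, (apply_nonneg _ x).ge_iff_eq', map_eq_zero]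
  · have hv := zero_lt_iff.2 ((padicValuation p E).ne_zero_iff.2 hy)
    have hN := map_pos_of_ne_zero (spectralMulAlgNorm ℚ_[p] E) hy
    have h := padicValuation_le_one_iff (p := p) (x := x / y)
    rw [← spectralMulAlgNorm_def, map_div₀, map_div₀, div_le_one₀ hv, div_le_one₀ hN] at h
    exact h

theorem padicValuation_lt_iff {x y : E} :
    padicValuation p E x < padicValuation p E y ↔
      spectralNorm ℚ_[p] E x < spectralNorm ℚ_[p] E y := by
  rw [← not_le, padicValuation_le_iff, not_le]

end PadicIntegers

section RamificationIndex

variable {p : ℕ} [Fact p.Prime] {E : Type*} [Field E] [Algebra ℚ_[p] E]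

theorem spectralNorm_natCast_self : spectralNorm ℚ_[p] E p = (p : ℝ)⁻¹ := by
  rw [← map_natCast (algebraMap ℚ_[p] E), spectralNorm_extends, Padic.norm_p]

variable [Algebra.IsAlgebraic ℚ_[p] E]

theorem padicValuation_algebraMap_lt_one_iff {c : ℚ_[p]} :
    padicValuation p E (algebraMap ℚ_[p] E c) < 1 ↔
      padicValuation p E (algebraMap ℚ_[p] E c) ≤ padicValuation p E p := by
  rw [← map_one (padicValuation p E), padicValuation_lt_iff, padicValuation_le_iff,
    spectralNorm_natCast_self, spectralNorm_one, spectralNorm_extends]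
  simpa using (Padic.norm_le_pow_iff_norm_lt_pow_add_one c (-1)).symm

theorem exists_padicValuation_mul_mem_Ioc (x : Eˣ) :
    ∃ c : ℚ_[p]ˣ, padicValuation p E (x * algebraMap ℚ_[p] E c) ∈
      Set.Ioc (padicValuation p E p) 1 := by
  have hp : 1 < (p : ℝ) := mod_cast (Fact.out : p.Prime).one_lt
  have hp0 : (p : ℚ_[p]) ≠ 0 := mod_cast (Fact.out : p.Prime).ne_zero
  have hx : 0 < spectralNorm ℚ_[p] E x := map_pos_of_ne_zero (spectralMulAlgNorm ℚ_[p] E) x.ne_zero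
  have hmul (c : ℚ_[p]) : spectralNorm ℚ_[p] E (x * algebraMap ℚ_[p] E c) =
      spectralNorm ℚ_[p] E x * ‖c‖ := by
    rw [← spectralNorm_extends (L := E) c]
    exact map_mul (spectralMulAlgNorm ℚ_[p] E) _ _
  obtain ⟨n, hlt, hle⟩ := exists_mem_Ioc_zpow hx hp
  refine ⟨Units.mk0 (p : ℚ_[p]) hp0 ^ (n + 1), ?_, ?_⟩
  · rw [padicValuation_lt_iff, hmul, spectralNorm_natCast_self]
    simp only [Units.val_zpow_eq_zpow_val, Units.val_mk0, Padic.norm_p_zpow, zpow_neg]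
    rwa [← div_eq_mul_inv, lt_div_iff₀ (by positivity), zpow_add_one₀ (by positivity), mul_comm,
      mul_inv_cancel_right₀ (by positivity)]
  · rw [padicValuation_le_one_iff, hmul]
    simp only [Units.val_zpow_eq_zpow_val, Units.val_mk0, Padic.norm_p_zpow, zpow_neg]
    exact mul_inv_le_one_of_le₀ hle (by positivity)

theorem mem_range_sup_range_iff_exists_padicValuation_eq {x : Eˣ} :
    x ∈ (Units.map (algebraMap ℚ_[p] E : ℚ_[p] →* E)).range ⊔
        (Units.map (algebraMap (padicIntegers p E) E : padicIntegers p E →* E)).range ↔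
      ∃ c : ℚ_[p], padicValuation p E x = padicValuation p E (algebraMap ℚ_[p] E c) := by
  have hv := valuation_integers (padicIntegers p E) E
  constructor
  · intro hx
    obtain ⟨_, ⟨c, rfl⟩, _, ⟨o, rfl⟩, rfl⟩ := Subgroup.mem_sup.1 hx
    refine ⟨c, ?_⟩
    have ho := hv.isUnit_iff_valuation_eq_one.1 o.isUnit
    change padicValuation p E (algebraMap ℚ_[p] E c * algebraMap _ E o.val) = _
    rw [map_mul, ho, mul_one]
  · rintro ⟨c, hc⟩
    have hc0 : c ≠ 0 := fun h0 => by simp [h0] at hc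
    have hc0' : algebraMap ℚ_[p] E c ≠ 0 := by simpa using hc0
    have hvo : padicValuation p E (x / algebraMap ℚ_[p] E c) = 1 := by
      rw [map_div₀, hc, div_self]
      simpa using hc0
    obtain ⟨o, ho⟩ := hv.exists_of_le_one hvo.le
    obtain ⟨o, rfl⟩ : IsUnit o := hv.isUnit_iff_valuation_eq_one.2 (by rw [ho, hvo])
    refine Subgroup.mem_sup.2 ⟨_, ⟨Units.mk0 c hc0, rfl⟩, _, ⟨o, rfl⟩, Units.ext ?_⟩
    change algebraMap ℚ_[p] E c * algebraMap _ E o.val = x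
    rw [ho, mul_div_cancel₀ _ hc0']

theorem padicValuation_le_of_div_eq_algebraMap {x y : E} (hx : padicValuation p E x ≤ 1)
    (hy : padicValuation p E p < padicValuation p E y) {c : ℚ_[p]}
    (hc : padicValuation p E y / padicValuation p E x = padicValuation p E (algebraMap ℚ_[p] E c)) :
    padicValuation p E x ≤ padicValuation p E y := by
  by_contra! hlt
  have hx0 : 0 < padicValuation p E x := zero_le.trans_lt hlt
  have hcp : padicValuation p E (algebraMap ℚ_[p] E c) ≤ padicValuation p E p := by
    rwa [← padicValuation_algebraMap_lt_one_iff, ← hc, div_lt_one₀ hx0]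
  rw [← hc, div_le_iff₀ hx0] at hcp
  exact hy.not_ge (hcp.trans (mul_le_of_le_one_right' hx))

theorem ramificationIndex_eq_encard_Ioc :
    ramificationIndex p E = (Set.Ioc (padicValuation p E p) 1).encard := by
  set v := padicValuation p E
  have himage : Set.Ioc (v p) 1 = (fun x : Eˣ => v x) '' {x | v x ∈ Set.Ioc (v p) 1} := by
    ext γ
    refine ⟨fun hγ => ?_, by rintro ⟨x, hx, rfl⟩; exact hx⟩
    obtain ⟨x, rfl⟩ := Quotient.mk_surjective γ
    exact ⟨Units.mk0 x (v.ne_zero_iff.1 (zero_le.trans_lt hγ.1).ne'), hγ, rfl⟩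
  rw [himage]
  refine card_quotient_eq_encard_image _ _ _ (fun x => ?_) fun x hx y hy => ?_
  · obtain ⟨c, hc⟩ := exists_padicValuation_mul_mem_Ioc (p := p) x
    refine ⟨x * Units.map (algebraMap ℚ_[p] E : ℚ_[p] →* E) c, hc, ?_⟩
    rw [QuotientGroup.leftRel_apply, inv_mul_cancel_left]
    exact Subgroup.mem_sup_left ⟨c, rfl⟩
  · have hratio : v (x⁻¹ * y : Eˣ) = v y / v x := by simp [mul_comm, div_eq_mul_inv]
    rw [QuotientGroup.leftRel_apply, mem_range_sup_range_iff_exists_padicValuation_eq, hratio]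
    refine ⟨?_, fun h => ⟨1, by simp [v, ← h]⟩⟩
    rintro ⟨c, hc⟩
    refine (padicValuation_le_of_div_eq_algebraMap hx.2 hy.1 hc).antisymm
      (padicValuation_le_of_div_eq_algebraMap hy.2 hx.1 (c := c⁻¹) ?_)
    rw [map_inv₀, map_inv₀, ← hc, inv_div]

end RamificationIndex

open scoped IntermediateField in
theorem exists_mem_adjoin_sq_add_self_add_one_eq_zero (K : Type*) {C : Type*}
    [NontriviallyNormedField K] [CompleteSpace K] [IsUltrametricDist K] [NormedField C]
    [NormedAlgebra K C] [Algebra.IsSeparable K C] [IsAlgClosed C] (h3 : ‖(3 : C)‖ = 1) {y : C}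
    (hy : ‖y ^ 2 + y + 1‖ < 1) : ∃ ω ∈ K⟮y⟯, ω ^ 2 + ω + 1 = 0 := by
  obtain ⟨ω, hω, hωy⟩ : ∃ ω : C, ω ^ 2 + ω + 1 = 0 ∧ ‖ω - y‖ < 1 := by
    have hdeg : (Polynomial.X ^ 2 + Polynomial.X + 1 : Polynomial C).degree = 2 := by
      compute_degree!
    obtain ⟨ω, hω⟩ := IsAlgClosed.exists_root _ (hdeg.trans_ne two_ne_zero)
    replace hω : ω ^ 2 + ω + 1 = 0 := by simpa using hω
    rw [show y ^ 2 + y + 1 = (ω - y) * (-1 - ω - y) by linear_combination hω, norm_mul] at hy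
    rcases lt_or_ge ‖ω - y‖ 1 with h | h
    · exact ⟨ω, hω, h⟩
    · refine ⟨-1 - ω, by linear_combination hω, ?_⟩
      by_contra! h'
      exact hy.not_ge (one_le_mul_of_one_le_of_one_le h h')
  refine ⟨ω, IsKrasner.krasner (Algebra.IsSeparable.isSeparable K ω) (IsAlgClosed.splits _)
    (Algebra.IsIntegral.isIntegral y) fun ω' hconj hne => hωy.trans_eq ?_, hω⟩
  have hω' : ω' ^ 2 + ω' + 1 = 0 := by
    have hdvd : minpoly K ω ∣ Polynomial.X ^ 2 + Polynomial.X + 1 := minpoly.dvd K ω (by simpa)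
    simpa using Polynomial.aeval_eq_zero_of_dvd_aeval_eq_zero hdvd hconj.aeval_eq_zero
  have hsum : ω' = -1 - ω :=
    mul_left_cancel₀ (sub_ne_zero.2 hne) (by linear_combination hω - hω')
  have hnorm : ‖2 * ω + 1‖ ^ 2 = 1 := by
    rw [← norm_pow, ← h3, ← norm_neg]
    congr 1
    linear_combination -4 * hω
  rw [hsum, show ω - (-1 - ω) = 2 * ω + 1 by ring]
  exact ((pow_eq_one_iff_of_nonneg (norm_nonneg _) two_ne_zero).1 hnorm).symm

section ResidueField

variable {p : ℕ} [Fact p.Prime] {E : Type*} [Field E] [Algebra ℚ_[p] E]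
  [Algebra.IsAlgebraic ℚ_[p] E]

open scoped IntermediateField in
theorem exists_sq_add_self_add_one_eq_zero (hp : p ≠ 3) {x : E}
    (hx : spectralNorm ℚ_[p] E (x ^ 2 + x + 1) < 1) : ∃ ω : E, ω ^ 2 + ω + 1 = 0 := by
  let C := AlgebraicClosure E
  have : Algebra.IsAlgebraic ℚ_[p] C := Algebra.IsAlgebraic.trans ℚ_[p] E C
  let : NormedField C := spectralNorm.normedField ℚ_[p] C
  let : NormedAlgebra ℚ_[p] C := spectralNorm.normedAlgebra ℚ_[p] C
  let i := IsScalarTower.toAlgHom ℚ_[p] E C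
  have h3 : ‖(3 : C)‖ = 1 := by
    have h : ‖((3 : ℕ) : ℚ_[p])‖ = 1 := Padic.norm_natCast_eq_one_iff.2
      ((Nat.coprime_primes Fact.out Nat.prime_three).2 hp)
    rwa [← norm_algebraMap' C, map_natCast, Nat.cast_ofNat] at h
  obtain ⟨ω, hω, hroot⟩ := exists_mem_adjoin_sq_add_self_add_one_eq_zero ℚ_[p] h3 (y := i x) (by
    rw [spectralNorm.eq_of_tower (L := C), map_add, map_add, map_pow, map_one] at hx
    exact hx)
  have hle : ℚ_[p]⟮i x⟯ ≤ i.fieldRange := IntermediateField.adjoin_simple_le_iff.2 ⟨x, rfl⟩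
  obtain ⟨ω, rfl⟩ := hle hω
  exact ⟨ω, i.injective (by simpa using hroot)⟩

theorem residueField_sq_add_self_add_one_ne_zero (hp : p ≠ 3) (h : ¬ IsSquare (-3 : E))
    (c : IsLocalRing.ResidueField (padicIntegers p E)) : c ^ 2 + c + 1 ≠ 0 := by
  obtain ⟨x, rfl⟩ := IsLocalRing.residue_surjective c
  intro hc
  have hlt : padicValuation p E (x ^ 2 + x + 1 : padicIntegers p E) < 1 := by
    have hv := valuation_integers (padicIntegers p E) E
    refine (hv.map_le_one (x ^ 2 + x + 1)).lt_of_ne fun hone => ?_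
    refine (IsLocalRing.residue_ne_zero_iff_isUnit _).2 (hv.isUnit_of_one' hone) ?_
    simpa using hc
  rw [← map_one (padicValuation p E), padicValuation_lt_iff, spectralNorm_one] at hlt
  obtain ⟨ω, hω⟩ := exists_sq_add_self_add_one_eq_zero (x := x.1) hp (by simpa using hlt)
  exact h ⟨2 * ω + 1, by linear_combination -4 * hω⟩

end ResidueField

/-! ### Splitting the Hamilton quaternions -/

theorem exists_sq_add_sq_eq_neg_one_of_sum_four_sq {K : Type*} [Field K] {a b c d : K}
    (ha : a ≠ 0) (h : a ^ 2 + b ^ 2 + c ^ 2 + d ^ 2 = 0) : ∃ x y : K, x ^ 2 + y ^ 2 = -1 := by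
  rcases eq_or_ne (a ^ 2 + b ^ 2) 0 with h0 | h0
  · refine ⟨b / a, 0, ?_⟩
    field_simp
    linear_combination h0
  · -- Sums of two squares are closed under multiplication.
    refine ⟨(a * c + b * d) / (a ^ 2 + b ^ 2), (a * d - b * c) / (a ^ 2 + b ^ 2), ?_⟩
    field_simp
    linear_combination (a ^ 2 + b ^ 2) * h

theorem isSquare_of_norm_sq_sub_lt {p : ℕ} [Fact p.Prime] {a x : ℤ_[p]}
    (h : ‖x ^ 2 - a‖ < ‖2 * x‖ ^ 2) : IsSquare a := by
  obtain ⟨z, hz, -⟩ := hensels_lemma (F := Polynomial.X ^ 2 - Polynomial.C a) (a := x)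
    (by simpa [one_add_one_eq_two] using h)
  exact ⟨z, by simpa [sub_eq_zero, sq, eq_comm] using hz⟩

theorem exists_padicInt_sq_add_sq_eq_neg_one {p : ℕ} [Fact p.Prime] (hp : p ≠ 2) :
    ∃ a b : ℤ_[p], a ^ 2 + b ^ 2 = -1 := by
  have hlt (z : ℤ_[p]) : ‖z‖ < 1 ↔ PadicInt.toZMod z = 0 := by
    rw [← RingHom.mem_ker, PadicInt.ker_toZMod, IsLocalRing.mem_maximalIdeal, PadicInt.mem_nonunits]
  obtain ⟨a, b, ha, hab⟩ : ∃ a b : ZMod p, a ≠ 0 ∧ a ^ 2 + b ^ 2 = -1 := by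
    obtain ⟨a, b, hab⟩ := ZMod.sq_add_sq p (-1)
    rcases eq_or_ne a 0 with rfl | ha
    · exact ⟨b, 0, by rintro rfl; simp at hab, by linear_combination hab⟩
    · exact ⟨a, b, ha, hab⟩
  obtain ⟨x, rfl⟩ := ZMod.ringHom_surjective (PadicInt.toZMod (p := p)) a
  obtain ⟨y, rfl⟩ := ZMod.ringHom_surjective (PadicInt.toZMod (p := p)) b
  have h2 : (2 : ZMod p) ≠ 0 := Ring.two_ne_zero (by rwa [ZMod.ringChar_zmod_n])
  have hnorm : ‖2 * x‖ = 1 := by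
    refine (PadicInt.norm_le_one _).antisymm (not_lt.1 fun h => mul_ne_zero h2 ha ?_)
    simpa only [map_mul, map_ofNat] using (hlt _).1 h
  obtain ⟨z, hz⟩ : IsSquare (-1 - y ^ 2) := isSquare_of_norm_sq_sub_lt (x := x) (by
    rw [hnorm, one_pow, hlt]
    simp only [map_sub, map_pow, map_neg, map_one]
    linear_combination hab)
  exact ⟨z, y, by linear_combination -hz⟩

theorem isSquare_of_toZModPow_three_eq_one {a : ℤ_[2]} (h : PadicInt.toZModPow 3 a = 1) :
    IsSquare a := by
  refine isSquare_of_norm_sq_sub_lt (x := 1) ?_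
  have hker : 1 - a ∈ RingHom.ker (PadicInt.toZModPow (p := 2) 3) := by
    rw [RingHom.mem_ker, map_sub, map_one, h, sub_self]
  rw [PadicInt.ker_toZModPow, ← PadicInt.norm_le_pow_iff_mem_span_pow] at hker
  have h2 : ‖(2 : ℤ_[2])‖ = 2⁻¹ := by simpa using PadicInt.norm_p (p := 2)
  rw [one_pow, mul_one, h2]
  refine hker.trans_lt ?_
  norm_num

theorem exists_isSquare_unit_mul_natCast (u : ℤ_[2]ˣ) :
    ∃ n ∈ ({1, 3, 5, 7} : Finset ℕ), IsSquare ((u : ℤ_[2]) * n) := by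
  have hmod : ∀ k : (ZMod (2 ^ 3))ˣ, ∃ n ∈ ({1, 3, 5, 7} : Finset ℕ), k.val * n = 1 := by decide
  obtain ⟨n, hn, hun⟩ := hmod (Units.map (PadicInt.toZModPow (p := 2) 3).toMonoidHom u)
  exact ⟨n, hn, isSquare_of_toZModPow_three_eq_one (by rw [map_mul, map_natCast]; exact hun)⟩

theorem exists_eq_unit_mul_zpow_valuation {p : ℕ} [Fact p.Prime] {d : ℚ_[p]} (hd : d ≠ 0) :
    ∃ u : ℤ_[p]ˣ, d = ((u : ℤ_[p]) : ℚ_[p]) * (p : ℚ_[p]) ^ d.valuation := by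
  have hp : (p : ℚ_[p]) ≠ 0 := mod_cast (Fact.out : p.Prime).ne_zero
  have hp' : (p : ℝ) ≠ 0 := mod_cast (Fact.out : p.Prime).ne_zero
  have hnorm : ‖d / (p : ℚ_[p]) ^ d.valuation‖ = 1 := by
    rw [norm_div, Padic.norm_p_zpow, Padic.norm_eq_zpow_neg_valuation hd,
      div_self (zpow_ne_zero _ hp')]
  exact ⟨PadicInt.mkUnits hnorm, (div_mul_cancel₀ d (zpow_ne_zero _ hp)).symm⟩

theorem exists_isSquare_mul_natCast {d : ℚ_[2]} (hd : d ≠ 0) :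
    ∃ n ∈ ({1, 2, 3, 5, 6, 7, 10, 14} : Finset ℕ), IsSquare (d * n) := by
  obtain ⟨u, hu⟩ := exists_eq_unit_mul_zpow_valuation hd
  obtain ⟨n, hn, r, hr⟩ := exists_isSquare_unit_mul_natCast u
  replace hr := congrArg ((↑) : ℤ_[2] → ℚ_[2]) hr
  push_cast at hr hu
  obtain ⟨k, hk | hk⟩ := Int.even_or_odd' d.valuation
  · refine ⟨n, by fin_cases hn <;> decide, r * 2 ^ k, ?_⟩
    rw [hu, hk, two_mul, zpow_add₀ two_ne_zero]
    linear_combination (2 : ℚ_[2]) ^ k * 2 ^ k * hr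
  · refine ⟨2 * n, by fin_cases hn <;> decide, r * 2 ^ (k + 1), ?_⟩
    rw [hu, hk, two_mul, zpow_add_one₀ two_ne_zero, zpow_add_one₀ two_ne_zero,
      zpow_add₀ two_ne_zero]
    push_cast
    linear_combination (2 : ℚ_[2]) ^ k * 2 ^ k * 4 * hr

theorem exists_mul_sum_three_sq_eq_neg_sq {d : ℚ_[2]} (hd : ¬ IsSquare d) :
    ∃ (a b c : ℕ) (t : ℚ_[2]), a ≠ 0 ∧ d * (a ^ 2 + b ^ 2 + c ^ 2) = -t ^ 2 := by
  have hd0 : -d ≠ 0 := neg_ne_zero.2 (by rintro rfl; exact hd (IsSquare.zero))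
  obtain ⟨n, hn, t, ht⟩ := exists_isSquare_mul_natCast hd0
  rcases eq_or_ne n 7 with rfl | h7
  · obtain ⟨r, hr⟩ := isSquare_of_toZModPow_three_eq_one (a := -7)
      (by rw [map_neg, map_ofNat]; decide)
    replace hr := congrArg ((↑) : ℤ_[2] → ℚ_[2]) hr
    push_cast at hr ht
    refine absurd ?_ hd
    have hd' : d = t * t / (r * r) := by
      rw [← hr, ← ht, show ((7 : ℤ_[2]) : ℚ_[2]) = 7 from rfl]
      ring
    exact hd' ▸ (IsSquare.mul_self t).div (IsSquare.mul_self _)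
  · have hsum : ∃ a b c : ℕ, a ≠ 0 ∧ a ^ 2 + b ^ 2 + c ^ 2 = n := by
      fin_cases hn
      exacts [⟨1, 0, 0, by simp⟩, ⟨1, 1, 0, by simp⟩, ⟨1, 1, 1, by simp⟩, ⟨2, 1, 0, by simp⟩,
        ⟨2, 1, 1, by simp⟩, absurd rfl h7, ⟨3, 1, 0, by simp⟩, ⟨3, 2, 1, by simp⟩]
    obtain ⟨a, b, c, ha, rfl⟩ := hsum
    exact ⟨a, b, c, t, ha, by push_cast at ht; linear_combination -ht⟩

open scoped IntermediateField in
theorem exists_sq_eq_algebraMap_of_isQuadraticExtension (K L : Type*) [Field K] [CharZero K]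
    [Field L] [Algebra K L] [Algebra.IsQuadraticExtension K L] :
    ∃ (δ : L) (d : K), ¬ IsSquare d ∧ δ ^ 2 = algebraMap K L d := by
  have h2 := Algebra.IsQuadraticExtension.finrank_eq_two K L
  have : NeZero (2 : K) := ⟨two_ne_zero⟩
  have hK : (primitiveRoots (Module.finrank K L) K).Nonempty :=
    ⟨-1, by rw [h2, mem_primitiveRoots two_pos]; exact IsPrimitiveRoot.neg_one 0 (by norm_num)⟩
  have : IsCyclic Gal(L/K) := by
    have : Fact (Nat.Prime 2) := ⟨Nat.prime_two⟩
    exact isCyclic_of_prime_card (p := 2) (by rw [IsGalois.card_aut_eq_finrank, h2])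
  obtain ⟨δ, ⟨d, hd⟩, htop⟩ := exists_root_adjoin_eq_top_of_isCyclic K L hK
  rw [h2] at hd
  refine ⟨δ, d, ?_, hd.symm⟩
  rintro ⟨s, rfl⟩
  have hδ : δ ∈ (⊥ : IntermediateField K L) := by
    rw [map_mul, ← sq, sq_eq_sq_iff_eq_or_eq_neg] at hd
    exact IntermediateField.mem_bot.2
      (hd.elim (fun h => ⟨s, h⟩) fun h => ⟨-s, by rw [map_neg, h, neg_neg]⟩)
  rw [IntermediateField.adjoin_simple_eq_bot_iff.2 hδ] at htop
  have := IntermediateField.finrank_bot (F := K) (E := L)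
  rw [htop, IntermediateField.finrank_top', h2] at this
  exact absurd this (by norm_num)

theorem exists_sq_add_sq_eq_neg_one_of_finrank_eq_two {E : Type*} [Field E] [Algebra ℚ_[2] E]
    (F : IntermediateField ℚ_[2] E) (hF : Module.finrank ℚ_[2] F = 2) :
    ∃ a b : F, a ^ 2 + b ^ 2 = -1 := by
  have : Algebra.IsQuadraticExtension ℚ_[2] F := ⟨hF⟩
  obtain ⟨δ, d, hd, hδ⟩ := exists_sq_eq_algebraMap_of_isQuadraticExtension ℚ_[2] F
  obtain ⟨a, b, c, t, ha, habc⟩ := exists_mul_sum_three_sq_eq_neg_sq hd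
  have hδ0 : δ ≠ 0 := by
    rintro rfl
    rw [zero_pow two_ne_zero, eq_comm, map_eq_zero] at hδ
    exact hd (hδ ▸ IsSquare.zero)
  have := charZero_of_injective_algebraMap (algebraMap ℚ_[2] F).injective
  refine exists_sq_add_sq_eq_neg_one_of_sum_four_sq (a := δ * a) (b := δ * b) (c := δ * c)
    (d := algebraMap ℚ_[2] F t) (mul_ne_zero hδ0 (Nat.cast_ne_zero.2 ha)) ?_
  replace habc := congrArg (algebraMap ℚ_[2] F) habc
  simp only [map_mul, map_add, map_pow, map_neg, map_natCast] at habc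
  linear_combination habc + (a ^ 2 + b ^ 2 + c ^ 2 : F) * hδ

section Splitting

variable {E : Type*} [Field E] [CharZero E] {a b : E}

/-- The images of the quaternion units in `M₂(E)` under the splitting of `𝔄_E` attached to a
solution of `a ^ 2 + b ^ 2 = -1`: the reflection-type matrices `j`, `k` have square `a ^ 2 + b ^ 2`
and anticommute with the rotation `i`. -/
def splittingBasis (hab : a ^ 2 + b ^ 2 = -1) :
    QuaternionAlgebra.Basis (Matrix (Fin 2) (Fin 2) E) (-1 : ℚ) 0 (-1) where
  i := !![0, -1; 1, 0]
  j := !![a, b; b, -a]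
  k := !![-b, a; a, b]
  i_mul_i := by simp [Matrix.one_fin_two]
  j_mul_j := by
    ext i j
    fin_cases i <;> fin_cases j <;> simp [Matrix.mul_apply]
    · linear_combination hab
    · ring
    · ring
    · linear_combination hab
  i_mul_j := by simp
  j_mul_i := by simp

/-- The `E`-algebra map `𝔄_E → M₂(E)` attached to `splittingBasis`; it is the splitting of `𝔄`. -/
def splittingHom (hab : a ^ 2 + b ^ 2 = -1) : E ⊗[ℚ] ℍ[ℚ] →ₐ[E] Matrix (Fin 2) (Fin 2) E :=
  Algebra.TensorProduct.lift (Algebra.ofId E _) (splittingBasis hab).liftHom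
    fun x _ => Algebra.commutes x _

theorem splittingHom_tmul (hab : a ^ 2 + b ^ 2 = -1) (c : E) (q : ℍ[ℚ]) :
    splittingHom hab (c ⊗ₜ q) = c • (algebraMap ℚ _ q.re + q.imI • !![0, -1; 1, 0] +
      q.imJ • !![a, b; b, -a] + q.imK • !![-b, a; a, b]) :=
  (Algebra.TensorProduct.lift_tmul _ _ _ c q).trans (Algebra.smul_def c _).symm

theorem splittingHom_surjective (hab : a ^ 2 + b ^ 2 = -1) :
    Function.Surjective (splittingHom hab) := by
  intro M
  let m := (M 0 0 - M 1 1) / 2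
  let n := (M 0 1 + M 1 0) / 2
  refine ⟨((M 0 0 + M 1 1) / 2) ⊗ₜ 1 + ((M 1 0 - M 0 1) / 2) ⊗ₜ hurwitzU.val +
    (-(a * m + b * n)) ⊗ₜ hurwitzV.val + (b * m - a * n) ⊗ₜ (hurwitzU * hurwitzV).val, ?_⟩
  simp only [map_add, splittingHom_tmul]
  ext i j
  fin_cases i <;> fin_cases j <;> simp [hurwitzU_coords, hurwitzV_coords, m, n]
  · linear_combination (-(M 0 0 - M 1 1) / 2) * hab
  · linear_combination (-(M 0 1 + M 1 0) / 2) * hab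
  · linear_combination (-(M 0 1 + M 1 0) / 2) * hab
  · linear_combination ((M 0 0 - M 1 1) / 2) * hab

theorem nonempty_hamiltonSplitting (hab : a ^ 2 + b ^ 2 = -1) : Nonempty (HamiltonSplitting E) := by
  have hsurj := splittingHom_surjective hab
  have hrank : Module.finrank E (E ⊗[ℚ] ℍ[ℚ]) = Module.finrank E (Matrix (Fin 2) (Fin 2) E) := by
    simp [Quaternion.finrank_eq_four, Module.finrank_matrix]
  have hinj : Function.Injective (splittingHom hab) :=
    (LinearMap.injective_iff_surjective_of_finrank_eq_finrank hrank).2 hsurj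
  exact ⟨AlgEquiv.ofBijective (splittingHom hab) ⟨hinj, hsurj⟩⟩

end Splitting

/-! ### Counting integral forms -/

theorem exists_integralClosure_sq_add_self_add_one_eq_zero (A : Type*) {E : Type*} [CommRing A]
    [Field E] [NeZero (2 : E)] [Algebra A E] (h : IsSquare (-3 : E)) :
    ∃ ω : integralClosure A E, ω ^ 2 + ω + 1 = 0 := by
  obtain ⟨s, hs⟩ := h
  have hω : ((s - 1) / 2) ^ 2 + (s - 1) / 2 + 1 = 0 := by
    field_simp
    linear_combination -hs
  have hω3 : ((s - 1) / 2) ^ 3 = 1 := by linear_combination ((s - 1) / 2 - 1) * hω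
  have hint : IsIntegral A ((s - 1) / 2) := .of_pow three_pos (by rw [hω3]; exact isIntegral_one)
  exact ⟨⟨_, hint⟩, Subtype.ext hω⟩

section Dyadic

variable {E : Type*} [Field E] [CharZero E] [Algebra ℚ_[2] E]

theorem nonempty_hamiltonSplitting_of_finrank_eq_two (F : IntermediateField ℚ_[2] E)
    (hF : Module.finrank ℚ_[2] F = 2) : Nonempty (HamiltonSplitting E) := by
  obtain ⟨a, b, hab⟩ := exists_sq_add_sq_eq_neg_one_of_finrank_eq_two F hF
  exact nonempty_hamiltonSplitting (a := (a : E)) (b := b) (mod_cast congrArg Subtype.val hab)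

variable [Algebra.IsAlgebraic ℚ_[2] E] (f : HamiltonSplitting E)

theorem card_integralForms_eq_ramificationIndex_add_one (h : IsSquare (-3 : E)) :
    ENat.card (IntegralForms (padicIntegers 2 E) (hurwitzRep f)) = ramificationIndex 2 E + 1 := by
  obtain ⟨ω, hω⟩ := exists_integralClosure_sq_add_self_add_one_eq_zero (PadicInt.subring 2) h
  have h3 : IsUnit (3 : padicIntegers 2 E) := by
    exact_mod_cast isUnit_natCast_padicIntegers (E := E) (p := 2) (n := 3) (by norm_num)
  have h2 : padicValuation 2 E 2 ≤ 1 := by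
    rw [← map_ofNat (algebraMap (padicIntegers 2 E) E) 2]
    exact (valuation_integers (padicIntegers 2 E) E).map_le_one 2
  rw [IntegralRep.card_integralForms_eq_encard_Icc hω h3, ← Set.Ioc_insert_left h2,
    Set.encard_insert_of_notMem Set.left_notMem_Ioc, ramificationIndex_eq_encard_Ioc,
    Nat.cast_ofNat]

theorem card_integralForms_eq_one_of_not_isSquare (h : ¬ IsSquare (-3 : E)) :
    ENat.card (IntegralForms (padicIntegers 2 E) (hurwitzRep f)) = 1 :=
  IntegralRep.card_integralForms_eq_one_of_isIrreducible_residual fun ρ' =>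
    ρ'.isIrreducible_residual_of_forall_ne_zero
      (residueField_sq_add_self_add_one_ne_zero (by norm_num) h)

end Dyadic

section Odd

variable {p : ℕ} [Fact p.Prime] (hp : p ≠ 2) {E : Type*} [Field E] [CharZero E] [Algebra ℚ_[p] E]
include hp

variable (E) in
theorem nonempty_hamiltonSplitting_of_ne_two : Nonempty (HamiltonSplitting E) := by
  obtain ⟨a, b, hab⟩ := exists_padicInt_sq_add_sq_eq_neg_one hp
  let g : ℤ_[p] →+* E := (algebraMap ℚ_[p] E).comp PadicInt.Coe.ringHom
  exact nonempty_hamiltonSplitting (a := g a) (b := g b)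
    (by rw [← map_pow, ← map_pow, ← map_add, hab, map_neg, map_one])

theorem card_integralForms_eq_one_of_ne_two [Algebra.IsAlgebraic ℚ_[p] E]
    (f : HamiltonSplitting E) :
    ENat.card (IntegralForms (padicIntegers p E) (hurwitzRep f)) = 1 := by
  have hcoprime : Nat.Coprime 2 p := (Nat.coprime_primes Nat.prime_two Fact.out).2 hp.symm
  have h2 : IsUnit (2 : padicIntegers p E) := mod_cast isUnit_natCast_padicIntegers hcoprime
  exact IntegralRep.card_integralForms_eq_one_of_isIrreducible_residual fun ρ' =>
    ρ'.isIrreducible_residual_of_isUnit_two h2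

end Odd

end

theorem theorem3_general :
    (∀ (E : Type*) [Field E] [CharZero E] [Algebra ℚ_[2] E] [Algebra.IsAlgebraic ℚ_[2] E],
      ((∃ F : IntermediateField ℚ_[2] E, Module.finrank ℚ_[2] F = 2) →
        Nonempty (HamiltonSplitting E)) ∧
        ∀ f : HamiltonSplitting E,
          (IsSquare (-3 : E) →
            ENat.card (IntegralForms (padicIntegers 2 E) (hurwitzRep f)) =
              ramificationIndex 2 E + 1) ∧
          (¬ IsSquare (-3 : E) →
            ENat.card (IntegralForms (padicIntegers 2 E) (hurwitzRep f)) = 1)) ∧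
    (∀ (p : ℕ) [Fact p.Prime], p ≠ 2 →
      ∀ (E : Type*) [Field E] [CharZero E] [Algebra ℚ_[p] E] [Algebra.IsAlgebraic ℚ_[p] E],
        Nonempty (HamiltonSplitting E) ∧
        ∀ f : HamiltonSplitting E,
          ENat.card (IntegralForms (padicIntegers p E) (hurwitzRep f)) = 1) := by
  refine ⟨fun E _ _ _ _ => ⟨?_, fun f => ⟨?_, ?_⟩⟩, fun p _ hp E _ _ _ _ => ⟨?_, fun f => ?_⟩⟩
  · rintro ⟨F, hF⟩
    exact nonempty_hamiltonSplitting_of_finrank_eq_two F hF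
  · exact card_integralForms_eq_ramificationIndex_add_one f
  · exact card_integralForms_eq_one_of_not_isSquare f
  · exact nonempty_hamiltonSplitting_of_ne_two hp E
  · exact card_integralForms_eq_one_of_ne_two hp f

theorem theorem3 :
    (∀ (E : Type*) [Field E] [CharZero E] [Algebra ℚ_[2] E] [IsGalois ℚ_[2] E],
      (∃ F : IntermediateField ℚ_[2] E, Module.finrank ℚ_[2] F = 2) →
        Nonempty (HamiltonSplitting E) ∧
        ∀ f : HamiltonSplitting E,
          (IsSquare (-3 : E) →
            ENat.card (IntegralForms (padicIntegers 2 E) (hurwitzRep f)) =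
              ramificationIndex 2 E + 1) ∧
          (¬ IsSquare (-3 : E) →
            ENat.card (IntegralForms (padicIntegers 2 E) (hurwitzRep f)) = 1)) ∧
    (∀ (p : ℕ) [Fact p.Prime], p ≠ 2 →
      ∀ (E : Type*) [Field E] [CharZero E] [Algebra ℚ_[p] E] [Algebra.IsAlgebraic ℚ_[p] E],
        Nonempty (HamiltonSplitting E) ∧
        ∀ f : HamiltonSplitting E,
          ENat.card (IntegralForms (padicIntegers p E) (hurwitzRep f)) = 1) :=
  theorem3_general.imp (fun h E _ _ _ _ hF => ⟨(h E).1 hF, (h E).2⟩) id
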